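/- All graphs are finite, simple and undirected. The \emph{New Eternal Vertex Cover} game on $G$ is played as follows. The defender first places guards on vertices, at most one per vertex. In each round the attacker chooses an edge $e$ of $G$; the defender answers by letting every guard stay where it is, move one step along an edge, or move two steps $x\to y\to z$ along edges with $z\neq x$ (no retracing), all simultaneously, so that at least one guard crosses $e$ in its first step and so that afterwards there is again at most one guard per vertex (several guards may pass through a vertex on the way). The defender wins if she can answer every infinite sequence of attacks. Let $nevc(G)$ be the least number of guards with which the defender has a winning strategy, and $mvc(G)$ the size of a minimum vertex cover of $G$. \textbf{Corollary.} There is a polynomial-time algorithm that, given a bipartite graph $G$, computes $nevc(G)$. (Precisely: there are a fixed program for a random access machine with addition and truncated subtraction as its only arithmetic, every elementary step having unit cost, and a polynomial $T$, such that for every $n$ and every bipartite graph $G$ on $n$ vertices, given by its adjacency matrix and without a bipartition, the program halts with output $nevc(G)$ after at most $T(n)$ steps.) Moreover, for every bipartite graph $G$: (1) if $G$ is connected, then $nevc(G)=mvc(G)$ or $nevc(G)=mvc(G)+1$; (2) $nevc(G)=mvc(G)$ if and only if every vertex of degree $1$ of $G$ lies in some minimum vertex cover of $G$; (3) for every vertex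 $v$ of degree $1$, the graph $G-v$ is bipartite, and $v$ lies in some minimum vertex cover of $G$ if and only if $mvc(G-v)+1=mvc(G)$; (4) in the same sense as above, there are polynomial-time algorithms on bipartite graphs $G$ that compute $mvc(G)$ and that decide whether every vertex of degree $1$ lies in some minimum vertex cover of $G$. -/

import Mathlib

/-! ### The New Eternal Vertex Cover game -/

namespace EternalVC

variable {V : Type*}

/-- A legal route of one guard during the answer to an attack: the guard is on `x` when the edge is
attacked, on `y` after its first step and finishes on `z`. It stays where it is, or makes one step,
or makes two steps without retracing the first one. -/
def IsRoute (G : SimpleGraph V) (x y z : V) : Prop :=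
  (y = x ∧ z = x) ∨ (G.Adj x y ∧ z = y) ∨ (G.Adj x y ∧ G.Adj y z ∧ z ≠ x)

/-- `Defends G S e T`: when the edge `e` is attacked, guards occupying the vertices of `S` (one on
each) can move simultaneously so that they occupy the vertices of `T` afterwards (again one on
each), and some guard crosses `e` in its first step. Several guards may pass through the same
vertex, or cross the same edge, on the way. -/
def Defends (G : SimpleGraph V) (S : Set V) (e : Sym2 V) (T : Set V) : Prop :=
  ∃ mid dst : V → V,
    (∀ x ∈ S, IsRoute G x (mid x) (dst x)) ∧
    Set.InjOn dst S ∧ dst '' S = T ∧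
    ∃ x ∈ S, s(x, mid x) = e

/-- A strategy of the defender prescribes the set of occupied vertices after every finite sequence
of attacks (listed with the most recent attack first); its value at `[]` is the initial placement. -/
abbrev Strategy (G : SimpleGraph V) : Type _ := List G.edgeSet → Set V

/-- A strategy is winning if every attack, after every history, is defended. -/
def Strategy.IsWinning {G : SimpleGraph V} (σ : Strategy G) : Prop :=
  ∀ (h : List G.edgeSet) (e : G.edgeSet), Defends G (σ h) e (σ (e :: h))

/-- The defender can defend every infinite sequence of attacks with `k` guards. -/
def DefenderWins (G : SimpleGraph V) (k : ℕ) : Prop :=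
  ∃ σ : Strategy G, (σ []).encard = k ∧ σ.IsWinning

/-- The New Eternal Vertex Cover number: the least number of guards with which the defender has a
winning strategy (on a finite graph, a guard on every vertex always suffices). -/
noncomputable def nevc (G : SimpleGraph V) : ℕ :=
  sInf {k : ℕ | DefenderWins G k}

/-- `S` is a vertex cover of `G` of the smallest possible size. -/
def IsMinVertexCover (G : SimpleGraph V) (S : Set V) : Prop :=
  G.IsVertexCover S ∧ S.encard = G.vertexCoverNum

/-- `v` has exactly one neighbour. -/
def IsDegreeOne (G : SimpleGraph V) (v : V) : Prop :=
  (G.neighborSet v).encard = 1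

/-- Every vertex of degree one lies in some minimum vertex cover. -/
def LeafCriterion (G : SimpleGraph V) : Prop :=
  ∀ v, IsDegreeOne G v → ∃ S, IsMinVertexCover G S ∧ v ∈ S

end EternalVC

/-! ### Random access machines with a step count, and polynomial time on graphs -/

namespace RAM

/-- A state of the machine: registers, addressed directly by the program, and a memory, addressed
indirectly through registers. All contents are natural numbers. -/
structure State where
  reg : ℕ → ℕ
  mem : ℕ → ℕ

/-- Write `a` into register `i`. -/
def State.setReg (s : State) (i a : ℕ) : State :=
  { s with reg := Function.update s.reg i a }

/-- Write `a` into the memory cell with address `i`. -/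
def State.setMem (s : State) (i a : ℕ) : State :=
  { s with mem := Function.update s.mem i a }

/-- Elementary instructions (`i`, `j`, `k` name registers). Addition and truncated subtraction are
the only arithmetic operations, so that the number of bits of every number that occurs grows at most
by one per step and the uniform cost measure below is polynomially related to the running time of
Turing machines. -/
inductive Instr where
  /-- `reg i := c` -/
  | const (i c : ℕ)
  /-- `reg i := reg j` -/
  | copy (i j : ℕ)
  /-- `reg i := reg j + reg k` -/
  | add (i j k : ℕ)
  /-- `reg i := reg j - reg k`, truncated at `0` -/
  | sub (i j k : ℕ)
  /-- `reg i := mem (reg j)` -/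
  | load (i j : ℕ)
  /-- `mem (reg i) := reg j` -/
  | store (i j : ℕ)

/-- The effect of an elementary instruction. -/
def Instr.apply : Instr → State → State
  | const i c, s => s.setReg i c
  | copy i j, s => s.setReg i (s.reg j)
  | add i j k, s => s.setReg i (s.reg j + s.reg k)
  | sub i j k, s => s.setReg i (s.reg j - s.reg k)
  | load i j, s => s.setReg i (s.mem (s.reg j))
  | store i j, s => s.setMem (s.reg i) (s.reg j)

/-- Programs. -/
inductive Prog where
  | instr (a : Instr)
  | seq (p q : Prog)
  /-- if `reg i ≠ 0` then `p` else `q` -/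
  | ite (i : ℕ) (p q : Prog)
  /-- while `reg i ≠ 0` do `p` -/
  | loop (i : ℕ) (p : Prog)

/-- `Exec p s s' t`: the program `p`, started in state `s`, halts in state `s'` after exactly `t`
steps. Every elementary instruction and every test of a register is one step. -/
inductive Exec : Prog → State → State → ℕ → Prop where
  | instr (a : Instr) (s : State) : Exec (.instr a) s (a.apply s) 1
  | seq {p q : Prog} {s₁ s₂ s₃ : State} {t₁ t₂ : ℕ} :
      Exec p s₁ s₂ t₁ → Exec q s₂ s₃ t₂ → Exec (.seq p q) s₁ s₃ (t₁ + t₂)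
  | ite_true {i : ℕ} {p q : Prog} {s s' : State} {t : ℕ} :
      s.reg i ≠ 0 → Exec p s s' t → Exec (.ite i p q) s s' (t + 1)
  | ite_false {i : ℕ} {p q : Prog} {s s' : State} {t : ℕ} :
      s.reg i = 0 → Exec q s s' t → Exec (.ite i p q) s s' (t + 1)
  | loop_done {i : ℕ} {p : Prog} {s : State} :
      s.reg i = 0 → Exec (.loop i p) s s 1
  | loop_step {i : ℕ} {p : Prog} {s₁ s₂ s₃ : State} {t₁ t₂ : ℕ} :
      s₁.reg i ≠ 0 → Exec p s₁ s₂ t₁ → Exec (.loop i p) s₂ s₃ t₂ →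
      Exec (.loop i p) s₁ s₃ (t₁ + t₂ + 1)

/-- Execution is deterministic: the final state and the number of steps are unique. -/
theorem Exec.unique {p : Prog} {s s₁ s₂ : State} {t₁ t₂ : ℕ}
    (h₁ : Exec p s s₁ t₁) (h₂ : Exec p s s₂ t₂) : s₁ = s₂ ∧ t₁ = t₂ := by
  induction h₁ generalizing s₂ t₂ with
  | instr a s => cases h₂; exact ⟨rfl, rfl⟩
  | seq _ _ ih₁ ih₂ =>
    cases h₂ with
    | seq ha hb =>
      obtain ⟨rfl, rfl⟩ := ih₁ ha
      obtain ⟨rfl, rfl⟩ := ih₂ hb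
      exact ⟨rfl, rfl⟩
  | ite_true hi _ ih =>
    cases h₂ with
    | ite_true _ ha => obtain ⟨rfl, rfl⟩ := ih ha; exact ⟨rfl, rfl⟩
    | ite_false hz _ => exact absurd hz hi
  | ite_false hi _ ih =>
    cases h₂ with
    | ite_true hz _ => exact absurd hi hz
    | ite_false _ ha => obtain ⟨rfl, rfl⟩ := ih ha; exact ⟨rfl, rfl⟩
  | loop_done hi =>
    cases h₂ with
    | loop_done _ => exact ⟨rfl, rfl⟩
    | loop_step hz _ _ => exact absurd hi hz
  | loop_step hi _ _ ih₁ ih₂ =>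
    cases h₂ with
    | loop_done hz => exact absurd hz hi
    | loop_step _ ha hb =>
      obtain ⟨rfl, rfl⟩ := ih₁ ha
      obtain ⟨rfl, rfl⟩ := ih₂ hb
      exact ⟨rfl, rfl⟩

open Classical in
/-- The input for a graph on the vertices `0, …, n - 1`: register `0` holds `n`, memory cell
`n * i + j` holds the entry of the adjacency matrix at `(i, j)`, and everything else is `0`. -/
noncomputable def graphInput {n : ℕ} (G : SimpleGraph (Fin n)) : State where
  reg := fun r => if r = 0 then n else 0
  mem := fun a => if ∃ i j : Fin n, a = n * (i : ℕ) + j ∧ G.Adj i j then 1 else 0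

/-- There is one program that, for every graph `G` with vertices `0, …, n - 1` in the class `C`,
halts on the adjacency matrix of `G` with `f G` in register `0`, after a number of steps that is
bounded by a polynomial in `n`. -/
def PolyTimeOnGraphs (C : ∀ {n : ℕ}, SimpleGraph (Fin n) → Prop)
    (f : ∀ {n : ℕ}, SimpleGraph (Fin n) → ℕ) : Prop :=
  ∃ (p : Prog) (T : Polynomial ℕ), ∀ (n : ℕ) (G : SimpleGraph (Fin n)), C G →
    ∃ (s : State) (t : ℕ), Exec p (graphInput G) s t ∧ s.reg 0 = f G ∧ t ≤ T.eval n

end RAM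

namespace EternalVC

open SimpleGraph

variable {V : Type*} {G : SimpleGraph V}

/-! ### Minimum vertex covers of finite graphs -/

/-! Call a leaf bad if it lies in no minimum vertex cover. For bipartite `G` the exact value is
`nevc G` = `mvc` + (number of components containing a bad leaf), which is `nevc_eq`; the criterion
and the dichotomy for connected graphs follow at once.

Lower bound (`Strategy.IsWinning.le_ncard`): every configuration of a winning strategy is a vertex
cover, and the number of guards in each component never changes. When the edge at a leaf is
attacked, the leaf is occupied before or after the answer, because a guard stepping onto it can only
go on by retracing. In a component holding only as many guards as a minimum cover needs, every
configuration restricts to a minimum cover there and so avoids a bad leaf. Hence each such component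
needs an additional guard.

Upper bound (`IsConfiguration.exists_defends`): the defender keeps a minimum cover `D` together with
one extra guard in each bad component. Let `uv` be attacked with `u` occupied. If `v` is occupied
too, the two guards swap. If `v` is empty and has another neighbour `w`, then `w` is occupied and
the guards on `u` and `w` trade places through `v`. If `v` is an empty leaf in a bad component, the
guards on a path from the extra guard to `u` are shifted, and the last one enters `v`
(`exists_shift`). If `v` is an empty leaf in a good component, `D` is exchanged there for a minimum
cover containing `v`, along a matching of `D` into its complement; this is where bipartiteness
enters, through Hall's theorem (`IsMinVertexCover.exists_matching`).

Algorithm: the adjacency matrix of `G` is that of its bipartite double cover, whose matching number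
is `2 * mvc` when `G` is bipartite, so no bipartition has to be found. An auction computes it
(`Auction.owned_eq`). A leaf `v` is bad iff isolating it does not lower the cover number by one
(`badLeaf_iff`), and components are found by propagating labels. All of this is written in a
language with bounded loops only, whose commands compile to machine programs of polynomial running
time (`Cmd.exists_compiles`). -/

theorem isMinVertexCover_iff [Finite V] {S : Set V} :
    IsMinVertexCover G S ↔
      G.IsVertexCover S ∧ ∀ T, G.IsVertexCover T → S.ncard ≤ T.ncard := by
  constructor
  · rintro ⟨hS, hc⟩
    refine ⟨hS, fun T hT => ?_⟩
    have h := hT.vertexCoverNum_le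
    rw [← hc, ← S.toFinite.cast_ncard_eq, ← T.toFinite.cast_ncard_eq] at h
    exact_mod_cast h
  · rintro ⟨hS, hmin⟩
    refine ⟨hS, le_antisymm ?_ hS.vertexCoverNum_le⟩
    obtain ⟨T, hTc, hT⟩ := vertexCoverNum_exists G
    rw [← hTc, ← S.toFinite.cast_ncard_eq, ← T.toFinite.cast_ncard_eq]
    exact_mod_cast hmin T hT

theorem exists_isMinVertexCover (G : SimpleGraph V) : ∃ S, IsMinVertexCover G S := by
  obtain ⟨T, hTc, hT⟩ := vertexCoverNum_exists G
  exact ⟨T, hT, hTc⟩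

theorem IsMinVertexCover.cast_ncard [Finite V] {S : Set V} (h : IsMinVertexCover G S) :
    (S.ncard : ℕ∞) = G.vertexCoverNum := by
  rw [S.toFinite.cast_ncard_eq, h.2]

theorem IsMinVertexCover.ncard_eq [Finite V] {S : Set V} (h : IsMinVertexCover G S) :
    S.ncard = G.vertexCoverNum.toNat := by
  rw [← h.cast_ncard, ENat.toNat_natCast]

theorem IsMinVertexCover.of_ncard_le [Finite V] {S T : Set V} (hS : IsMinVertexCover G S)
    (hT : G.IsVertexCover T) (h : T.ncard ≤ S.ncard) : IsMinVertexCover G T :=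
  isMinVertexCover_iff.2 ⟨hT, fun U hU => h.trans ((isMinVertexCover_iff.1 hS).2 U hU)⟩

theorem IsMinVertexCover.ncard_le [Finite V] {S T : Set V} (hS : IsMinVertexCover G S)
    (hT : G.IsVertexCover T) : S.ncard ≤ T.ncard :=
  (isMinVertexCover_iff.1 hS).2 T hT

/-- A leaf that lies in no minimum vertex cover. -/
def BadLeaf (G : SimpleGraph V) (v : V) : Prop :=
  IsDegreeOne G v ∧ ∀ S, IsMinVertexCover G S → v ∉ S

/-- The connected components that contain a leaf lying in no minimum vertex cover. -/
def badComponents (G : SimpleGraph V) : Set G.ConnectedComponent :=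
  G.connectedComponentMk '' {v | BadLeaf G v}

theorem leafCriterion_iff : LeafCriterion G ↔ ∀ v, ¬ BadLeaf G v := by
  unfold LeafCriterion BadLeaf
  exact forall_congr' fun v => by push Not; rfl

theorem isDegreeOne_iff {v : V} : IsDegreeOne G v ↔ ∃ u, G.Adj v u ∧ ∀ w, G.Adj v w → w = u := by
  unfold IsDegreeOne
  rw [Set.encard_eq_one]
  refine exists_congr fun u => ?_
  constructor
  · intro h
    refine ⟨by rw [← mem_neighborSet, h]; rfl, fun w hw => ?_⟩
    rw [← mem_neighborSet, h] at hw
    exact hw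
  · rintro ⟨h, h'⟩
    ext w
    exact ⟨fun hw => h' w hw, fun hw => by rw [Set.mem_singleton_iff.1 hw]; exact h⟩

/-- No edge joins different components, so covers can be glued along them. -/
theorem IsVertexCover.mix {S C : Set V} (hS : G.IsVertexCover S) (hC : G.IsVertexCover C)
    (c : G.ConnectedComponent) : G.IsVertexCover (S ∩ c.supp ∪ C \ c.supp) := by
  intro x y hxy
  have hc : x ∈ c.supp ↔ y ∈ c.supp := by
    rw [ConnectedComponent.mem_supp_iff, ConnectedComponent.mem_supp_iff,
      ConnectedComponent.connectedComponentMk_eq_of_adj hxy]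
  have h1 := hS hxy
  have h2 := hC hxy
  simp only [Set.mem_union, Set.mem_inter_iff, Set.mem_sdiff]
  tauto

theorem ncard_mix [Finite V] (S C : Set V) (c : G.ConnectedComponent) :
    (S ∩ c.supp ∪ C \ c.supp).ncard + (C ∩ c.supp).ncard = (S ∩ c.supp).ncard + C.ncard := by
  rw [Set.ncard_union_eq (Set.disjoint_left.2 fun x hx hx' => hx'.2 hx.2),
    ← Set.ncard_inter_add_ncard_sdiff_eq_ncard C c.supp]
  ring

/-- Otherwise exchanging the part of `C` in `c` for that of `S` would give a smaller cover. -/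
theorem IsMinVertexCover.ncard_inter_le [Finite V] {S C : Set V} (hC : IsMinVertexCover G C)
    (hS : G.IsVertexCover S) (c : G.ConnectedComponent) :
    (C ∩ c.supp).ncard ≤ (S ∩ c.supp).ncard := by
  have h1 := hC.ncard_le (IsVertexCover.mix hS hC.1 c)
  have h2 := ncard_mix S C c
  omega

theorem IsMinVertexCover.mix [Finite V] {S C : Set V} (hC : IsMinVertexCover G C)
    (hS : G.IsVertexCover S) {c : G.ConnectedComponent}
    (h : (S ∩ c.supp).ncard ≤ (C ∩ c.supp).ncard) :
    IsMinVertexCover G (S ∩ c.supp ∪ C \ c.supp) := by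
  have h2 := ncard_mix S C c
  exact hC.of_ncard_le (IsVertexCover.mix hS hC.1 c) (by omega)

theorem ncard_eq_sum_components [Finite V] [Fintype G.ConnectedComponent] (S : Set V) :
    S.ncard = ∑ c : G.ConnectedComponent, (S ∩ c.supp).ncard := by
  classical
  have := Fintype.ofFinite V
  rw [Set.ncard_eq_toFinset_card', Finset.card_eq_sum_card_fiberwise
    (f := G.connectedComponentMk) (t := Finset.univ) (fun _ _ => Finset.mem_coe.2 (Finset.mem_univ _))]
  refine Finset.sum_congr rfl fun c _ => ?_
  rw [Set.ncard_eq_toFinset_card']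
  congr 1
  ext x
  simp

/-! ### Lower bound -/

/-- Routes stay inside a component and destinations are distinct. -/
theorem Defends.ncard_inter [Finite V] {S T : Set V} {e : Sym2 V} (h : Defends G S e T)
    (c : G.ConnectedComponent) : (T ∩ c.supp).ncard = (S ∩ c.supp).ncard := by
  obtain ⟨mid, dst, hr, hinj, rfl, -⟩ := h
  have hmem : ∀ x ∈ S, (dst x ∈ c.supp ↔ x ∈ c.supp) := by
    intro x hx
    simp only [ConnectedComponent.mem_supp_iff]
    rcases hr x hx with ⟨-, h⟩ | ⟨h, h'⟩ | ⟨h, h', -⟩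
    · rw [h]
    · rw [h', ConnectedComponent.connectedComponentMk_eq_of_adj h]
    · rw [ConnectedComponent.connectedComponentMk_eq_of_adj h,
        ConnectedComponent.connectedComponentMk_eq_of_adj h']
  have : dst '' S ∩ c.supp = dst '' (S ∩ c.supp) := by
    ext y
    constructor
    · rintro ⟨⟨x, hx, rfl⟩, hy⟩
      exact ⟨x, ⟨hx, (hmem x hx).1 hy⟩, rfl⟩
    · rintro ⟨x, ⟨hx, hc⟩, rfl⟩
      exact ⟨⟨x, hx, rfl⟩, (hmem x hx).2 hc⟩
  rw [this, (hinj.mono Set.inter_subset_left).ncard_image]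

/-- Any edge may be attacked next, and the guard that crosses it must start at one of its ends. -/
theorem Strategy.IsWinning.isVertexCover {σ : Strategy G} (hσ : σ.IsWinning)
    (h : List G.edgeSet) : G.IsVertexCover (σ h) := by
  intro u v huv
  obtain ⟨mid, dst, -, -, -, x, hx, he⟩ := hσ h ⟨s(u, v), huv⟩
  have : x ∈ s(u, v) := by
    change _ = s(u, v) at he
    rw [← he]
    exact Sym2.mem_mk_left _ _
  rcases Sym2.mem_iff.1 this with rfl | rfl
  · exact Or.inl hx
  · exact Or.inr hx

/-- After an attack on the edge at a leaf, the leaf was or is occupied. -/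
theorem Defends.leaf_mem {S T : Set V} {u v : V} (hv : ∀ w, G.Adj v w → w = u)
    (h : Defends G S s(u, v) T) : v ∈ S ∨ v ∈ T := by
  obtain ⟨mid, dst, hr, -, rfl, x, hx, he⟩ := h
  rcases Sym2.eq_iff.1 he with ⟨rfl, h2⟩ | ⟨rfl, -⟩
  · rcases hr x hx with ⟨h3, -⟩ | ⟨-, h4⟩ | ⟨-, h4, h5⟩
    · rw [h2] at h3; subst h3; exact Or.inl hx
    · exact Or.inr ⟨x, hx, h4.trans h2⟩
    -- A second step from the leaf could only lead back to `u`, which is retracing.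
    · rw [h2] at h4; exact absurd (hv _ h4) h5
  · exact Or.inl hx

/-- If the component had no surplus guard, any configuration with that many guards there, completed
by `C` elsewhere, would be a minimum cover and hence avoid `v`; this applies both before and after
an attack on the edge at `v`. -/
theorem Strategy.IsWinning.ncard_inter_lt [Finite V] {σ : Strategy G} (hσ : σ.IsWinning)
    {C : Set V} (hC : IsMinVertexCover G C) {v : V} (hv : BadLeaf G v) :
    (C ∩ (G.connectedComponentMk v).supp).ncard <
      (σ [] ∩ (G.connectedComponentMk v).supp).ncard := by
  by_contra! hle
  obtain ⟨u, huv, hu⟩ := isDegreeOne_iff.1 hv.1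
  have hd := hσ [] ⟨s(u, v), huv.symm⟩
  have hmem : ∀ h, (σ h ∩ (G.connectedComponentMk v).supp).ncard ≤
      (C ∩ (G.connectedComponentMk v).supp).ncard → v ∉ σ h := fun h hh hvS =>
    hv.2 _ (hC.mix (hσ.isVertexCover h) hh) (Or.inl ⟨hvS, rfl⟩)
  rcases hd.leaf_mem hu with h | h
  · exact hmem _ hle h
  · exact hmem _ (by rw [hd.ncard_inter]; exact hle) h

theorem Strategy.IsWinning.le_ncard [Finite V] {σ : Strategy G} (hσ : σ.IsWinning) :
    G.vertexCoverNum.toNat + (badComponents G).ncard ≤ (σ []).ncard := by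
  classical
  have := Fintype.ofFinite G.ConnectedComponent
  obtain ⟨C, hC⟩ := exists_isMinVertexCover G
  rw [← hC.ncard_eq, ncard_eq_sum_components (G := G) C, ncard_eq_sum_components (G := G) (σ []),
    Set.ncard_eq_toFinset_card', Finset.card_eq_sum_ones, ← Finset.sum_filter_add_sum_filter_not
      Finset.univ (fun c => c ∈ badComponents G) (fun c => (C ∩ c.supp).ncard),
    ← Finset.sum_filter_add_sum_filter_not
      Finset.univ (fun c => c ∈ badComponents G) (fun c => (σ [] ∩ c.supp).ncard)]
  have h1 : ∑ c ∈ Finset.univ.filter (fun c => c ∈ badComponents G), (C ∩ c.supp).ncard +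
      ∑ c ∈ (badComponents G).toFinset, 1 ≤
      ∑ c ∈ Finset.univ.filter (fun c => c ∈ badComponents G), (σ [] ∩ c.supp).ncard := by
    rw [show (badComponents G).toFinset = Finset.univ.filter (fun c => c ∈ badComponents G) by
      ext; simp, ← Finset.sum_add_distrib]
    refine Finset.sum_le_sum fun c hc => ?_
    obtain ⟨v, hv, rfl⟩ := (Finset.mem_filter.1 hc).2
    exact hσ.ncard_inter_lt hC hv
  have h2 : ∑ c ∈ Finset.univ.filter (fun c => ¬ c ∈ badComponents G), (C ∩ c.supp).ncard ≤
      ∑ c ∈ Finset.univ.filter (fun c => ¬ c ∈ badComponents G), (σ [] ∩ c.supp).ncard :=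
    Finset.sum_le_sum fun c _ => hC.ncard_inter_le (hσ.isVertexCover []) c
  omega

/-! ### Upper bound -/

/-- An invariant that can be restored after every attack gives a memoryless strategy. Histories list
the latest attack first, hence the right fold. -/
theorem exists_isWinning (P : Set V → Prop) {S₀ : Set V} (h₀ : P S₀)
    (hP : ∀ S, P S → ∀ e ∈ G.edgeSet, ∃ T, P T ∧ Defends G S e T) :
    ∃ σ : Strategy G, σ [] = S₀ ∧ σ.IsWinning := by
  choose! f hf using hP
  let σ : Strategy G := fun h => h.foldr (fun e S => f S e) S₀
  have hσ : ∀ h, P (σ h) := by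
    intro h
    induction h with
    | nil => exact h₀
    | cons e h ih => exact (hf _ ih e e.2).1
  exact ⟨σ, rfl, fun h e => (hf _ (hσ h) e e.2).2⟩

theorem Defends.of_mapsTo [Finite V] {S T : Set V} {e : Sym2 V} (mid dst : V → V)
    (hr : ∀ x ∈ S, IsRoute G x (mid x) (dst x)) (hinj : Set.InjOn dst S)
    (hmaps : Set.MapsTo dst S T) (hc : T.ncard ≤ S.ncard) (he : ∃ x ∈ S, s(x, mid x) = e) :
    Defends G S e T :=
  ⟨mid, dst, hr, hinj, Set.eq_of_subset_of_ncard_le (Set.image_subset_iff.2 hmaps)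
    (by rwa [hinj.ncard_image]), he⟩

open Classical in
theorem swap_image {S : Set V} {u v : V} (hu : u ∈ S) (hv : v ∈ S) :
    Equiv.swap u v '' S = S := by
  rw [Equiv.image_eq_preimage_symm, Equiv.symm_swap]
  ext x
  rw [Set.mem_preimage, Equiv.swap_apply_def]
  split_ifs with h1 h2
  · subst h1; tauto
  · subst h2; tauto
  · rfl

theorem Defends.of_both_mem {S : Set V} {u v : V} (huv : G.Adj u v) (hu : u ∈ S) (hv : v ∈ S) :
    Defends G S s(u, v) S := by
  classical
  refine ⟨Equiv.swap u v, Equiv.swap u v, fun x _ => ?_, (Equiv.injective _).injOn, ?_,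
    u, hu, by rw [Equiv.swap_apply_left]⟩
  · rcases eq_or_ne x u with rfl | h1
    · rw [Equiv.swap_apply_left]; exact Or.inr (Or.inl ⟨huv, rfl⟩)
    · rcases eq_or_ne x v with rfl | h2
      · rw [Equiv.swap_apply_right]; exact Or.inr (Or.inl ⟨huv.symm, rfl⟩)
      · rw [Equiv.swap_apply_of_ne_of_ne h1 h2]; exact Or.inl ⟨rfl, rfl⟩
  · exact swap_image hu hv

/-- The guards on `u` and `w` trade places, walking through `v` in opposite directions; `w ≠ u`
makes both routes free of retracing. -/
theorem Defends.of_second_neighbor {S : Set V} {u v w : V} (huv : G.Adj u v) (hvw : G.Adj v w)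
    (hwu : w ≠ u) (hu : u ∈ S) (hw : w ∈ S) : Defends G S s(u, v) S := by
  classical
  refine ⟨fun x => if x = u ∨ x = w then v else x, Equiv.swap u w, fun x _ => ?_,
    (Equiv.injective _).injOn, ?_, u, hu, by simp⟩
  · rcases eq_or_ne x u with rfl | h1
    · simp only [Equiv.swap_apply_left, true_or, if_true]
      exact Or.inr (Or.inr ⟨huv, hvw, hwu⟩)
    · rcases eq_or_ne x w with rfl | h2
      · simp only [Equiv.swap_apply_right, or_true, if_true]
        exact Or.inr (Or.inr ⟨hvw.symm, huv.symm, hwu.symm⟩)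
      · simp only [Equiv.swap_apply_of_ne_of_ne h1 h2, h1, h2, or_self, if_false]
        exact Or.inl ⟨rfl, rfl⟩
  · exact swap_image hu hw

/-- Guards can be shifted along a path towards its end `u`, from where a guard moves to `v`. -/
theorem exists_shift {D : Set V} (hD : G.IsVertexCover D) {u v : V} (huv : G.Adj u v)
    (hu : u ∈ D) : ∀ (n : ℕ) {x : V} (p : G.Walk x u), p.length = n → p.IsPath →
    ∃ mid dst : V → V, mid u = v ∧ (∀ y ∉ p.support, mid y = y ∧ dst y = y) ∧
      (∀ y ∈ p.support, y = x ∨ y ∈ D → IsRoute G y (mid y) (dst y) ∧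
        ((dst y ∈ p.support ∧ dst y ∈ D ∧ dst y ≠ x) ∨ dst y = v)) ∧
      (v ∉ D → Set.InjOn dst {y | y ∈ p.support ∧ (y = x ∨ y ∈ D)}) := by
  classical
  intro n
  induction n using Nat.strong_induction_on with
  | _ n ih =>
  intro x p hn hp
  by_cases hxu : x = u
  · subst hxu
    obtain rfl := Walk.eq_nil_iff_nil.2 (Walk.isPath_iff_nil.1 hp)
    refine ⟨Function.update id x v, Function.update id x v, by simp, fun y hy => ?_,
      fun y hy _ => ?_, fun _ y hy z hz _ => ?_⟩
    · have : y ≠ x := by simpa using hy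
      simp [this]
    · have : y = x := by simpa using hy
      subst this
      exact ⟨Or.inr (Or.inl ⟨by simpa using huv, rfl⟩), by simp⟩
    · have h1 : y = x := by simpa using hy.1
      have h2 : z = x := by simpa using hz.1
      rw [h1, h2]
  -- The guard on `x` moves to the next vertex `y` of the path if `y ∈ D`. Otherwise it goes on to
  -- the vertex `z` after `y`, which is in `D` because `D` covers the edge `yz`; such a `z` exists
  -- since `u ∈ D`. The guard it displaces is handled by induction on the remaining path `q`.
  · obtain ⟨y, z, q, hr, hq, hlen, hsub, hx, hz, hD⟩ : ∃ (y z : V) (q : G.Walk z u),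
        IsRoute G x y z ∧ q.IsPath ∧ q.length < n ∧ q.support ⊆ p.support ∧ x ∉ q.support ∧
        z ∈ D ∧ ∀ w ∈ p.support, w ∈ D → w = x ∨ w ∈ q.support := by
      cases p with
      | nil => exact absurd rfl hxu
      | @cons _ y _ h p =>
        rw [Walk.cons_isPath_iff] at hp
        by_cases hy : y ∈ D
        · refine ⟨y, y, p, Or.inr (Or.inl ⟨h, rfl⟩), hp.1, by simp [← hn], by simp, hp.2, hy, ?_⟩
          intro w hw _
          simpa using hw
        · cases p with
          | nil => exact absurd hu hy
          | @cons _ z _ h' p =>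
            rw [Walk.cons_isPath_iff] at hp
            have hzx : z ≠ x := by
              rintro rfl
              exact hp.2 (by simp)
            refine ⟨y, z, p, Or.inr (Or.inr ⟨h, h', hzx⟩), hp.1.1, by simp [← hn], ?_, ?_,
              (hD h').resolve_left hy, ?_⟩
            · intro w hw
              simp [hw]
            · intro hx
              exact hp.2 (by simp [hx])
            · intro w hw hwD
              have : w ≠ y := fun h => hy (h ▸ hwD)
              simpa [this] using hw
    obtain ⟨mid, dst, hm, h1, h2, h3⟩ := ih _ hlen q rfl hq
    refine ⟨Function.update mid x y, Function.update dst x z, ?_, ?_, ?_, ?_⟩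
    · rw [Function.update_of_ne (Ne.symm hxu), hm]
    · intro w hw
      have hwx : w ≠ x := fun h => hw (h ▸ p.start_mem_support)
      rw [Function.update_of_ne hwx, Function.update_of_ne hwx]
      exact h1 w fun h => hw (hsub h)
    · intro w hw hwD
      by_cases hwx : w = x
      · subst hwx
        rw [Function.update_self, Function.update_self]
        exact ⟨hr, Or.inl ⟨hsub q.start_mem_support, hz, fun h => hx (h ▸ q.start_mem_support)⟩⟩
      · have hwD' := hwD.resolve_left hwx
        have hwq := (hD w hw hwD').resolve_left hwx
        rw [Function.update_of_ne hwx, Function.update_of_ne hwx]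
        refine ⟨(h2 w hwq (Or.inr hwD')).1, (h2 w hwq (Or.inr hwD')).2.imp_left ?_⟩
        exact fun h => ⟨hsub h.1, h.2.1, fun h' => hx (h' ▸ h.1)⟩
    · intro hv w hw w' hw' heq
      -- No guard of the tail ends on `z`: the induction hypothesis excludes its starting vertex as
      -- a destination, apart from `v`, which is not in `D`.
      have key : ∀ w, w ∈ {y | y ∈ p.support ∧ (y = x ∨ y ∈ D)} → w ≠ x →
          w ∈ {y | y ∈ q.support ∧ (y = z ∨ y ∈ D)} ∧ dst w ≠ z := by
        intro w hw hwx
        have hwD' := hw.2.resolve_left hwx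
        have hwq := (hD w hw.1 hwD').resolve_left hwx
        refine ⟨⟨hwq, Or.inr hwD'⟩, ?_⟩
        rcases (h2 w hwq (Or.inr hwD')).2 with h | h
        · exact h.2.2
        · rw [h]
          exact fun h => hv (h ▸ hz)
      by_cases hwx : w = x <;> by_cases hwx' : w' = x
      · rw [hwx, hwx']
      · rw [hwx, Function.update_self, Function.update_of_ne hwx'] at heq
        exact absurd heq.symm (key w' hw' hwx').2
      · rw [hwx', Function.update_self, Function.update_of_ne hwx] at heq
        exact absurd heq (key w hw hwx).2
      · rw [Function.update_of_ne hwx, Function.update_of_ne hwx'] at heq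
        exact h3 hv (key w hw hwx).1 (key w' hw' hwx').1 heq

/-- In a bipartite graph, a minimum vertex cover can be matched into its complement. -/
theorem IsMinVertexCover.exists_matching [Finite V] (hG : G.IsBipartite) {D : Set V}
    (hD : IsMinVertexCover G D) :
    ∃ f : V → V, (∀ x ∈ D, G.Adj x (f x) ∧ f x ∉ D) ∧ Set.InjOn f D := by
  classical
  have := Fintype.ofFinite V
  obtain ⟨col⟩ := hG
  let t : D → Finset V := fun x => Finset.univ.filter fun y => G.Adj x y ∧ y ∉ D
  -- Hall's condition for sets of one colour. Replacing `A` in `D` by its neighbours outside `D`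
  -- leaves a cover, since neighbours of `A` inside `D` have the other colour and are kept;
  -- minimality of `D` then compares the sizes.
  have key : ∀ (A : Finset V) (i : Fin 2), (∀ x ∈ A, x ∈ D ∧ col x = i) →
      A.card ≤ (Finset.univ.filter fun y => (∃ x ∈ A, G.Adj x y) ∧ y ∉ D).card := by
    intro A i hA
    have hcov : G.IsVertexCover
        ((D \ A) ∪ (Finset.univ.filter fun y => (∃ x ∈ A, G.Adj x y) ∧ y ∉ D : Finset V)) := by
      have aux : ∀ x y, G.Adj x y → x ∈ D → x ∈ ((D \ A) ∪ (Finset.univ.filter fun y =>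
          (∃ x ∈ A, G.Adj x y) ∧ y ∉ D : Finset V) : Set V) ∨ y ∈ ((D \ A) ∪
          (Finset.univ.filter fun y => (∃ x ∈ A, G.Adj x y) ∧ y ∉ D : Finset V) : Set V) := by
        intro x y hxy hx
        have hne := col.valid hxy
        simp only [Finset.coe_filter, Finset.mem_univ, true_and, Set.mem_union, Set.mem_sdiff,
          Finset.mem_coe, Set.mem_ofPred_eq]
        by_cases hxA : x ∈ A
        · right
          by_cases hy : y ∈ D
          · exact Or.inl ⟨hy, fun hyA => hne ((hA x hxA).2.trans (hA y hyA).2.symm)⟩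
          · exact Or.inr ⟨⟨x, hxA, hxy⟩, hy⟩
        · exact Or.inl (Or.inl ⟨hx, hxA⟩)
      intro x y hxy
      rcases hD.1 hxy with h | h
      · exact aux x y hxy h
      · exact (aux y x hxy.symm h).symm
    have h1 := (hD.ncard_le hcov).trans (Set.ncard_union_le _ _)
    rw [Set.ncard_coe_finset] at h1
    have h2 := Set.ncard_sdiff_add_ncard_of_subset (s := (A : Set V)) (t := D)
      (fun x hx => (hA x hx).1)
    rw [Set.ncard_coe_finset] at h2
    omega
  -- The neighbours of the two colour classes of `s` have opposite colours, so the two one-coloured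
  -- bounds add up.
  have hall : ∀ s : Finset D, s.card ≤ (s.biUnion t).card := by
    intro s
    have hbi : ∀ i, (Finset.univ.filter fun y =>
        (∃ x ∈ (s.map (Function.Embedding.subtype _)).filter (fun x => col x = i), G.Adj x y) ∧
          y ∉ D) ⊆ (s.biUnion t).filter fun y => col y = i + 1 := by
      intro i y hy
      simp only [Finset.mem_filter, Finset.mem_univ, true_and, Finset.mem_map,
        Function.Embedding.subtype_apply] at hy
      obtain ⟨⟨x, ⟨⟨x', hx', rfl⟩, hc⟩, hxy⟩, hyD⟩ := hy
      refine Finset.mem_filter.2 ⟨Finset.mem_biUnion.2 ⟨x', hx', by simp [t, hxy, hyD]⟩, ?_⟩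
      have := col.valid hxy
      rw [hc] at this
      clear hc
      revert this
      generalize col y = j
      revert i j
      decide
    have hk : ∀ i, ((s.map (Function.Embedding.subtype _)).filter fun x => col x = i).card ≤
        ((s.biUnion t).filter fun y => col y = i + 1).card := fun i =>
      (key _ i fun x hx => by
        simp only [Finset.mem_filter, Finset.mem_map, Function.Embedding.subtype_apply] at hx
        obtain ⟨⟨x', -, rfl⟩, hc⟩ := hx
        exact ⟨x'.2, hc⟩).trans (Finset.card_le_card (hbi i))
    have h0 := hk 0
    have h1 := hk 1
    rw [← Finset.card_map (Function.Embedding.subtype _),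
      Finset.card_eq_sum_card_fiberwise (f := col) (t := Finset.univ)
        (fun _ _ => Finset.mem_coe.2 (Finset.mem_univ _)),
      Finset.card_eq_sum_card_fiberwise (s := s.biUnion t) (f := col) (t := Finset.univ)
        (fun _ _ => Finset.mem_coe.2 (Finset.mem_univ _)), Fin.sum_univ_two, Fin.sum_univ_two]
    change _ ≤ (Finset.filter (fun y => col y = 1) _).card at h0
    change _ ≤ (Finset.filter (fun y => col y = 0) _).card at h1
    omega
  obtain ⟨f, hf, hft⟩ := (Finset.all_card_le_biUnion_card_iff_exists_injective t).1 hall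
  have hft' : ∀ x : D, G.Adj x (f x) ∧ f x ∉ D := fun x => by simpa [t] using hft x
  refine ⟨fun x => if h : x ∈ D then f ⟨x, h⟩ else x, fun x hx => ?_, fun x hx y hy h => ?_⟩
  · simpa [hx] using hft' ⟨x, hx⟩
  · simp only [hx, hy, dif_pos] at h
    exact congrArg Subtype.val (hf h)

/-- The configurations of the defender: a minimum vertex cover and an additional guard in every
component that contains a bad leaf. -/
def IsConfiguration (G : SimpleGraph V) (S : Set V) : Prop :=
  ∃ D X : Set V, IsMinVertexCover G D ∧ Disjoint D X ∧ S = D ∪ X ∧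
    Set.BijOn G.connectedComponentMk X (badComponents G)

theorem exists_isConfiguration [Finite V] (G : SimpleGraph V) : ∃ S, IsConfiguration G S ∧
    S.ncard = G.vertexCoverNum.toNat + (badComponents G).ncard := by
  obtain ⟨D, hD⟩ := exists_isMinVertexCover G
  -- One bad leaf is chosen in each bad component; bad leaves lie outside `D` by definition.
  obtain ⟨X, hX, hbij⟩ := (Set.surjOn_image G.connectedComponentMk
    {v | BadLeaf G v}).exists_bijOn_subset
  have hdis : Disjoint D X := Set.disjoint_left.2 fun x hx hx' => (hX hx').2 D hD hx
  refine ⟨D ∪ X, ⟨D, X, hD, hdis, rfl, hbij⟩, ?_⟩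
  rw [Set.ncard_union_eq hdis, hD.ncard_eq]
  congr 1
  rw [← hbij.injOn.ncard_image, hbij.image_eq, badComponents]

/-- The cover `D` stays occupied. Shifting along a path to `u` empties the place `x` of the extra
guard and fills `v`, which becomes the place of the extra guard of this component. -/
theorem exists_defends_of_bad [Finite V] {D X : Set V} (hD : IsMinVertexCover G D)
    (hdis : Disjoint D X) (hbij : Set.BijOn G.connectedComponentMk X (badComponents G)) {u v : V}
    (huv : G.Adj u v) (hu : u ∈ D) (hv : v ∉ D ∪ X)
    (hbad : G.connectedComponentMk v ∈ badComponents G) :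
    ∃ T, IsConfiguration G T ∧ Defends G (D ∪ X) s(u, v) T := by
  classical
  have hvD : v ∉ D := fun h => hv (Or.inl h)
  obtain ⟨x, hx, hxv⟩ := hbij.surjOn hbad
  have hxD : x ∉ D := Set.disjoint_right.1 hdis hx
  have hreach : G.Reachable x u :=
    (ConnectedComponent.exact hxv).trans huv.symm.reachable
  obtain ⟨p, hp⟩ := hreach.exists_isPath
  obtain ⟨mid, dst, hm, h1, h2, h3⟩ := exists_shift hD.1 huv hu _ p rfl hp
  -- The path stays in one component, and `X` has a single vertex there.
  have hsupp : ∀ y ∈ D ∪ X, y ∈ p.support → y = x ∨ y ∈ D := by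
    rintro y (hy | hy) hyp
    · exact Or.inr hy
    · left
      exact hbij.injOn hy hx (ConnectedComponent.sound (p.takeUntil y hyp).reachable).symm
  refine ⟨insert v ((D ∪ X) \ {x}), ⟨D, insert v (X \ {x}), hD, ?_, ?_, ?_, ?_, ?_⟩,
    Defends.of_mapsTo mid dst ?_ ?_ ?_ ?_ ⟨u, Or.inl hu, by rw [hm]⟩⟩
  · rw [Set.disjoint_insert_right]
    exact ⟨hvD, hdis.mono_right Set.sdiff_subset⟩
  · ext y
    simp only [Set.mem_insert_iff, Set.mem_sdiff, Set.mem_union, Set.mem_singleton_iff]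
    by_cases hyx : y = x
    · subst hyx; tauto
    · tauto
  · rintro y (rfl | hy)
    · exact hbad
    · exact hbij.mapsTo hy.1
  · have key : ∀ y ∈ X \ {x}, G.connectedComponentMk y ≠ G.connectedComponentMk v :=
      fun y hy h => hy.2 (hbij.injOn hy.1 hx (h.trans hxv.symm))
    rintro y (rfl | hy) z (rfl | hz) h
    · rfl
    · exact absurd h.symm (key z hz)
    · exact absurd h (key y hy)
    · exact hbij.injOn hy.1 hz.1 h
  · intro c hc
    obtain ⟨y, hy, rfl⟩ := hbij.surjOn hc
    by_cases hyx : y = x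
    · exact ⟨v, Or.inl rfl, by rw [hyx, hxv]⟩
    · exact ⟨y, Or.inr ⟨hy, hyx⟩, rfl⟩
  · intro y hy
    by_cases hyp : y ∈ p.support
    · exact (h2 y hyp (hsupp y hy hyp)).1
    · exact Or.inl (h1 y hyp)
  · have key : ∀ y ∈ D ∪ X, ∀ z ∈ D ∪ X, y ∈ p.support → z ∉ p.support → dst y ≠ dst z := by
      intro y hy z hz hyp hzp h
      rw [(h1 z hzp).2] at h
      rcases (h2 y hyp (hsupp y hy hyp)).2 with h' | h'
      · exact hzp (h ▸ h'.1)
      · exact hv (h'.symm.trans h ▸ hz)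
    intro y hy z hz h
    by_cases hyp : y ∈ p.support <;> by_cases hzp : z ∈ p.support
    · exact h3 hvD ⟨hyp, hsupp y hy hyp⟩ ⟨hzp, hsupp z hz hzp⟩ h
    · exact absurd h (key y hy z hz hyp hzp)
    · exact absurd h.symm (key z hz y hy hzp hyp)
    · rwa [(h1 y hyp).2, (h1 z hzp).2] at h
  · intro y hy
    by_cases hyp : y ∈ p.support
    · rcases (h2 y hyp (hsupp y hy hyp)).2 with h | h
      · exact Or.inr ⟨Or.inl h.2.1, h.2.2⟩
      · exact Or.inl h
    · rw [(h1 y hyp).2]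
      exact Or.inr ⟨hy, fun h => hyp (h ▸ p.start_mem_support)⟩
  · have h := Set.ncard_insert_le v ((D ∪ X) \ {x})
    have h' := Set.ncard_sdiff_singleton_add_one (show x ∈ D ∪ X from Or.inr hx)
    omega

/-- Inside the component of `v`, `D` is replaced by a minimum cover containing `v`. Guards that
leave `D` move along their matching edges, and a count shows that they fill the new cover exactly;
the one arriving at the leaf `v` has to come from `u`. -/
theorem exists_defends_of_good [Finite V] (hG : G.IsBipartite) {D X : Set V}
    (hD : IsMinVertexCover G D) (hdis : Disjoint D X)
    (hbij : Set.BijOn G.connectedComponentMk X (badComponents G)) {u v : V}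
    (huv : G.Adj u v) (hleaf : ∀ w, G.Adj v w → w = u) (hv : v ∉ D ∪ X)
    (hgood : G.connectedComponentMk v ∉ badComponents G) :
    ∃ T, IsConfiguration G T ∧ Defends G (D ∪ X) s(u, v) T := by
  classical
  obtain ⟨f, hf, hfinj⟩ := hD.exists_matching hG
  obtain ⟨T₀, hT₀, hvT₀⟩ : ∃ T₀, IsMinVertexCover G T₀ ∧ v ∈ T₀ := by
    by_contra! h
    exact hgood ⟨v, ⟨isDegreeOne_iff.2 ⟨u, huv.symm, hleaf⟩, h⟩, rfl⟩
  set c := G.connectedComponentMk v with hc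
  set D' := T₀ ∩ c.supp ∪ D \ c.supp with hD'def
  have hD' : IsMinVertexCover G D' := hD.mix hT₀.1 (hT₀.ncard_inter_le hD.1 c)
  have hdis' : Disjoint D' X := by
    rw [Set.disjoint_left]
    rintro y (hy | hy) hyX
    · have := hbij.mapsTo hyX
      rw [(ConnectedComponent.mem_supp_iff _ _).1 hy.2] at this
      exact hgood this
    · exact Set.disjoint_left.1 hdis hy.1 hyX
  let dst : V → V := fun y => if y ∈ D ∧ y ∉ D' then f y else y
  have hX : ∀ y ∈ X, dst y = y := fun y hy => if_neg fun h => Set.disjoint_right.1 hdis hy h.1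
  have hmaps : Set.MapsTo dst D D' := by
    intro y hy
    by_cases h : y ∈ D'
    · simp [dst, h]
    -- `D'` covers the matching edge at `y` but misses `y`, so it contains `f y`.
    · simpa [dst, h, hy] using (hD'.1 (hf y hy).1).resolve_left h
  have hinj : Set.InjOn dst D := by
    intro y hy z hz h
    by_cases h1 : y ∈ D' <;> by_cases h2 : z ∈ D' <;>
      simp only [dst, h1, h2, hy, hz, not_true_eq_false, not_false_eq_true, and_true, and_false,
        if_true, if_false] at h
    · exact h
    · exact absurd (h ▸ hy) (hf z hz).2
    · exact absurd (h ▸ hz) (hf y hy).2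
    · exact hfinj hy hz h
  have himage : dst '' D = D' := Set.eq_of_subset_of_ncard_le (Set.image_subset_iff.2 hmaps)
    (by rw [hinj.ncard_image, hD.ncard_eq, hD'.ncard_eq])
  have hvD' : v ∈ D' := Or.inl ⟨hvT₀, rfl⟩
  obtain ⟨y, hy, hyv⟩ : v ∈ dst '' D := himage ▸ hvD'
  have hyv' : dst y = f y := if_pos ⟨hy, fun h => hv (Or.inl (by
    have : dst y = y := if_neg fun h' => h'.2 h
    rw [← hyv, this]
    exact hy))⟩
  obtain rfl : y = u := hleaf y (by rw [← hyv, hyv']; exact (hf y hy).1.symm)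
  refine ⟨D' ∪ X, ⟨D', X, hD', hdis', rfl, hbij⟩, dst, dst, ?_, ?_, ?_, y, Or.inl hy, by rw [hyv]⟩
  · intro z _
    by_cases h : z ∈ D ∧ z ∉ D'
    · exact Or.inr (Or.inl ⟨by simpa [dst, h] using (hf z h.1).1, rfl⟩)
    · exact Or.inl ⟨if_neg h, if_neg h⟩
  · rintro z (hz | hz) w (hw | hw) h
    · exact hinj hz hw h
    · rw [hX w hw] at h
      exact absurd (h ▸ hmaps hz) (Set.disjoint_right.1 hdis' hw)
    · rw [hX z hz] at h
      exact absurd (h ▸ hmaps hw) (Set.disjoint_right.1 hdis' hz)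
    · rwa [hX z hz, hX w hw] at h
  · rw [Set.image_union, himage]
    congr 1
    exact (Set.image_congr hX).trans (Set.image_id' X)

/-- An empty end with a second neighbour, or an edge with both ends occupied, is answered without
changing the configuration; only empty leaves require a new one. -/
theorem IsConfiguration.exists_defends [Finite V] (hG : G.IsBipartite) {S : Set V}
    (hS : IsConfiguration G S) (e : Sym2 V) (he : e ∈ G.edgeSet) :
    ∃ T, IsConfiguration G T ∧ Defends G S e T := by
  have main : ∀ u v, G.Adj u v → u ∈ S → ∃ T, IsConfiguration G T ∧ Defends G S s(u, v) T := by
    intro u v huv hu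
    by_cases hv : v ∈ S
    · exact ⟨S, hS, Defends.of_both_mem huv hu hv⟩
    by_cases hleaf : ∀ w, G.Adj v w → w = u
    · obtain ⟨D, X, hD, hdis, rfl, hbij⟩ := hS
      by_cases hbad : G.connectedComponentMk v ∈ badComponents G
      · have huD : u ∈ D := (hD.1 huv).resolve_right fun h => hv (Or.inl h)
        exact exists_defends_of_bad hD hdis hbij huv huD hv hbad
      · exact exists_defends_of_good hG hD hdis hbij huv hleaf hv hbad
    · push Not at hleaf
      obtain ⟨w, hvw, hwu⟩ := hleaf
      have hcov : G.IsVertexCover S := by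
        obtain ⟨D, X, hD, -, rfl, -⟩ := hS
        exact hD.1.subset Set.subset_union_left
      exact ⟨S, hS, Defends.of_second_neighbor huv hvw hwu hu ((hcov hvw).resolve_left hv)⟩
  induction e using Sym2.ind with
  | _ u v =>
    have hcov : G.IsVertexCover S := by
      obtain ⟨D, X, hD, -, rfl, -⟩ := hS
      exact hD.1.subset Set.subset_union_left
    rcases hcov he with h | h
    · exact main u v he h
    · rw [Sym2.eq_swap]
      exact main v u (G.adj_symm he) h

/-! ### The value of the game -/

theorem nevc_eq [Finite V] (hG : G.IsBipartite) :
    nevc G = G.vertexCoverNum.toNat + (badComponents G).ncard := by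
  obtain ⟨S, hS, hc⟩ := exists_isConfiguration G
  obtain ⟨σ, hσS, hσ⟩ := exists_isWinning (IsConfiguration G) hS
    fun S hS e he => hS.exists_defends hG e he
  have hwin : DefenderWins G (G.vertexCoverNum.toNat + (badComponents G).ncard) :=
    ⟨σ, by rw [hσS, ← hc, S.toFinite.cast_ncard_eq], hσ⟩
  refine le_antisymm (Nat.sInf_le hwin) ?_
  obtain ⟨τ, hτ, hτw⟩ := Nat.sInf_mem (s := {k | DefenderWins G k}) ⟨_, hwin⟩
  refine hτw.le_ncard.trans (le_of_eq ?_)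
  rw [← (τ []).toFinite.cast_ncard_eq] at hτ
  exact_mod_cast hτ

theorem badComponents_eq_empty : badComponents G = ∅ ↔ LeafCriterion G := by
  rw [badComponents, Set.image_eq_empty, leafCriterion_iff, Set.eq_empty_iff_forall_notMem]
  rfl

theorem coe_vertexCoverNum_toNat [Finite V] :
    ((G.vertexCoverNum.toNat : ℕ) : ℕ∞) = G.vertexCoverNum :=
  ENat.natCast_toNat vertexCoverNum_ne_top_of_finite

theorem nevc_eq_vertexCoverNum_iff [Finite V] (hG : G.IsBipartite) :
    (nevc G : ℕ∞) = G.vertexCoverNum ↔ LeafCriterion G := by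
  rw [← coe_vertexCoverNum_toNat, nevc_eq hG, ← badComponents_eq_empty, Nat.cast_inj,
    ← Set.ncard_eq_zero]
  omega

theorem nevc_of_connected [Finite V] (hG : G.IsBipartite) (hconn : G.Connected) :
    (nevc G : ℕ∞) = G.vertexCoverNum ∨ (nevc G : ℕ∞) = G.vertexCoverNum + 1 := by
  have := hconn.preconnected.subsingleton_connectedComponent
  have h : (badComponents G).ncard ≤ 1 :=
    Set.ncard_le_one_iff_subsingleton.2 Set.subsingleton_of_subsingleton
  rw [← coe_vertexCoverNum_toNat, nevc_eq hG]
  norm_cast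
  omega

/-- Adding and removing `v` translates between covers of `G - v` and covers of `G` through `v`. The
inequality `mvc(G) ≤ mvc(G - v) + 1` always holds, and equality says that a best cover of `G - v`
together with `v` is optimal. -/
theorem exists_isMinVertexCover_mem_iff [Finite V] (v : V) :
    (∃ S, IsMinVertexCover G S ∧ v ∈ S) ↔
      (G.induce {v}ᶜ).vertexCoverNum + 1 = G.vertexCoverNum := by
  have hup : ∀ S : Set ({v}ᶜ : Set V), (G.induce {v}ᶜ).IsVertexCover S →
      G.IsVertexCover (insert v (Subtype.val '' S)) := by
    intro S hS x y hxy
    by_cases hx : x = v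
    · exact Or.inl (Or.inl hx)
    by_cases hy : y = v
    · exact Or.inr (Or.inl hy)
    rcases @hS ⟨x, hx⟩ ⟨y, hy⟩ hxy with h | h
    · exact Or.inl (Or.inr ⟨_, h, rfl⟩)
    · exact Or.inr (Or.inr ⟨_, h, rfl⟩)
  have hcard : ∀ S : Set ({v}ᶜ : Set V), (insert v (Subtype.val '' S)).ncard = S.ncard + 1 := by
    intro S
    rw [Set.ncard_insert_of_notMem, Set.ncard_image_of_injective _ Subtype.val_injective]
    rintro ⟨x, -, hx⟩
    exact x.2 hx
  obtain ⟨S₁, hS₁⟩ := exists_isMinVertexCover (G.induce {v}ᶜ)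
  obtain ⟨S₂, hS₂⟩ := exists_isMinVertexCover G
  have hle := hS₂.ncard_le (hup S₁ hS₁.1)
  rw [hcard] at hle
  rw [← hS₁.cast_ncard, ← hS₂.cast_ncard]
  norm_cast
  constructor
  · rintro ⟨S, hS, hv⟩
    refine le_antisymm ?_ hle
    have hdown : (G.induce {v}ᶜ).IsVertexCover (Subtype.val ⁻¹' S) := fun x y hxy => hS.1 hxy
    have h1 := hS₁.ncard_le hdown
    have h2 : insert v (Subtype.val '' (Subtype.val ⁻¹' S : Set ({v}ᶜ : Set V))) = S := by
      ext x
      by_cases hx : x = v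
      · subst hx; simp [hv]
      · simp [hx]
    have h3 := hcard (Subtype.val ⁻¹' S)
    rw [h2, hS.ncard_eq, ← hS₂.ncard_eq] at h3
    omega
  · intro h
    exact ⟨_, hS₂.of_ncard_le (hup S₁ hS₁.1) (by rw [hcard, h]), Set.mem_insert _ _⟩

end EternalVC

namespace RAM

/-! ### A small imperative language that compiles to the machine -/

/-- Expressions over named variables, eight arrays, the input memory, and the input size, with
sums over a variable that ranges below the input size. -/
inductive Expr where
  | size
  | const (c : ℕ)
  | var (x : ℕ)
  | add (a b : Expr)
  | sub (a b : Expr)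
  | get (k : Fin 8) (i : Expr)
  | inp (i : Expr)
  | ite (c a b : Expr)
  | sum (x : ℕ) (a : Expr)

/-- The contents of the eight arrays. -/
abbrev Arrays := Fin 8 → ℕ → ℕ

/-- The value of an expression for size `n`, input `M`, variables `ρ` and arrays `A`. -/
def Expr.eval (n : ℕ) (M : ℕ → ℕ) : Expr → (ℕ → ℕ) → Arrays → ℕ
  | size, _, _ => n
  | const c, _, _ => c
  | var x, ρ, _ => ρ x
  | add a b, ρ, A => a.eval n M ρ A + b.eval n M ρ A
  | sub a b, ρ, A => a.eval n M ρ A - b.eval n M ρ A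
  | get k i, ρ, A => A k (i.eval n M ρ A)
  | inp i, ρ, A => M (i.eval n M ρ A)
  | ite c a b, ρ, A => if c.eval n M ρ A ≠ 0 then a.eval n M ρ A else b.eval n M ρ A
  | sum x a, ρ, A => ∑ v ∈ Finset.range n, a.eval n M (Function.update ρ x v) A

/-- Commands: array assignment, composition, conditional execution, and a loop over all values of a variable
below the input size. -/
inductive Cmd where
  | set (k : Fin 8) (i a : Expr)
  | seq (p q : Cmd)
  | when (c : Expr) (p : Cmd)
  | loop (x : ℕ) (p : Cmd)

/-- Apply `f 0`, …, `f (n - 1)` in this order. -/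
def iter {α : Type*} (f : ℕ → α → α) : ℕ → α → α
  | 0, a => a
  | k + 1, a => f k (iter f k a)

/-- The effect of a command on the arrays. -/
def Cmd.run (n : ℕ) (M : ℕ → ℕ) : Cmd → (ℕ → ℕ) → Arrays → Arrays
  | set k i a, ρ, A => Function.update A k
      (Function.update (A k) (i.eval n M ρ A) (a.eval n M ρ A))
  | seq p q, ρ, A => q.run n M ρ (p.run n M ρ A)
  | when c p, ρ, A => if c.eval n M ρ A ≠ 0 then p.run n M ρ A else A
  | loop x p, ρ, A => iter (fun v A => p.run n M (Function.update ρ x v) A) n A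

/-- The machine state `s` represents input `M`, variables `ρ` and arrays `A`. Variables live in
the even registers from `2` on, the odd registers from `3` on are for intermediate results, and the
arrays are interleaved behind the `q` cells of the input. -/
structure Represents (n q : ℕ) (M ρ : ℕ → ℕ) (A : Arrays) (s : State) : Prop where
  reg_zero : s.reg 0 = n
  reg_one : s.reg 1 = q
  reg_var : ∀ x, s.reg (2 * x + 2) = ρ x
  mem_inp : ∀ a < q, s.mem a = M a
  inp_eq_zero : ∀ a, q ≤ a → M a = 0
  mem_arr : ∀ (k : Fin 8) (i : ℕ), s.mem (8 * i + k + q) = A k i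

/-- Registers that a computation with intermediate results at level `d` or above preserves. -/
def Protected (d r : ℕ) : Prop := r < 2 * d + 3 ∨ r % 2 = 0

theorem Represents.of_eq {n q : ℕ} {M ρ : ℕ → ℕ} {A : Arrays} {s s' : State} {d : ℕ}
    (h : Represents n q M ρ A s) (hm : s'.mem = s.mem)
    (hr : ∀ r, Protected d r → s'.reg r = s.reg r) : Represents n q M ρ A s' where
  reg_zero := by rw [hr 0 (Or.inr rfl), h.reg_zero]
  reg_one := by rw [hr 1 (Or.inl (by omega)), h.reg_one]
  reg_var x := by rw [hr _ (Or.inr (by omega)), h.reg_var]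
  mem_inp := by rw [hm]; exact h.mem_inp
  inp_eq_zero := h.inp_eq_zero
  mem_arr := by rw [hm]; exact h.mem_arr

theorem State.setReg_reg (s : State) (i a r : ℕ) :
    (s.setReg i a).reg r = if r = i then a else s.reg r := by
  simp [State.setReg, Function.update_apply]

@[simp] theorem State.setReg_reg_self (s : State) (i a : ℕ) : (s.setReg i a).reg i = a := by
  simp [State.setReg]

theorem State.setReg_reg_of_ne (s : State) {i r : ℕ} (a : ℕ) (h : r ≠ i) :
    (s.setReg i a).reg r = s.reg r := by
  simp [State.setReg, h]

@[simp] theorem State.setReg_mem (s : State) (i a : ℕ) : (s.setReg i a).mem = s.mem := rfl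

@[simp] theorem State.setMem_reg (s : State) (i a : ℕ) : (s.setMem i a).reg = s.reg := rfl

@[simp] theorem State.setMem_mem (s : State) (i a r : ℕ) :
    (s.setMem i a).mem r = if r = i then a else s.mem r := by
  simp [State.setMem, Function.update_apply]

/-- A register that counts down from `n` to `0` controls `n` rounds of a loop. -/
theorem Exec.exists_loop {p : Prog} {c n B : ℕ} (P : ℕ → State → Prop)
    (hc : ∀ k s, P k s → s.reg c = n - k)
    (hP : ∀ k < n, ∀ s, P k s → ∃ s' t, Exec p s s' t ∧ t ≤ B ∧ P (k + 1) s')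
    {s : State} (h₀ : P 0 s) :
    ∃ s' t, Exec (.loop c p) s s' t ∧ t ≤ n * (B + 1) + 1 ∧ P n s' := by
  have key : ∀ m ≤ n, ∀ s, P (n - m) s →
      ∃ s' t, Exec (.loop c p) s s' t ∧ t ≤ m * (B + 1) + 1 ∧ P n s' := by
    intro m
    induction m with
    | zero =>
      intro _ s hs
      exact ⟨s, 1, .loop_done (by rw [hc _ _ hs]; omega), by omega, hs⟩
    | succ m ih =>
      intro hm s hs
      obtain ⟨s₁, t₁, he, ht, hs₁⟩ := hP _ (by omega) s hs
      rw [show n - (m + 1) + 1 = n - m by omega] at hs₁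
      obtain ⟨s₂, t₂, he', ht', hs₂⟩ := ih (by omega) s₁ hs₁
      refine ⟨s₂, _, .loop_step (by rw [hc _ _ hs]; omega) he he', ?_, hs₂⟩
      rw [Nat.succ_mul]
      omega
  exact key n le_rfl s (by rwa [Nat.sub_self])

/-- `p` evaluates `e` into the register of level `d`, in time `T`. -/
def Expr.Compiles (e : Expr) (d : ℕ) (p : Prog) (T : Polynomial ℕ) : Prop :=
  ∀ n q M ρ A s, Represents n q M ρ A s → ∃ s' t, Exec p s s' t ∧ t ≤ T.eval n ∧
    s'.mem = s.mem ∧ (∀ r, Protected d r → s'.reg r = s.reg r) ∧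
    s'.reg (2 * d + 3) = e.eval n M ρ A

theorem Expr.compiles_of_instr {e : Expr} {d : ℕ} (a : Instr) (g : State → ℕ)
    (ha : ∀ s, a.apply s = s.setReg (2 * d + 3) (g s))
    (h : ∀ n q M ρ A s, Represents n q M ρ A s → g s = e.eval n M ρ A) :
    e.Compiles d (.instr a) 1 := by
  intro n q M ρ A s hs
  refine ⟨_, _, .instr _ _, by simp, by simp (disch := omega) [ha], fun r hr => ?_, ?_⟩
  · have : r ≠ 2 * d + 3 := by unfold Protected at hr; omega
    simp (disch := omega) [State.setReg_reg_of_ne, ha]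
  · simp (disch := omega) [ha, h n q M ρ A s hs]

/-- The value of `a` waits in register `2 * d + 3`, which the evaluation of `b` at level `d + 1`
protects. -/
theorem Expr.compiles_binary {a b e : Expr} {d : ℕ} {p p' : Prog} {T T' : Polynomial ℕ}
    (i : Instr) (g : ℕ → ℕ → ℕ)
    (hi : ∀ s, i.apply s = s.setReg (2 * d + 3) (g (s.reg (2 * d + 3)) (s.reg (2 * d + 5))))
    (he : ∀ n M ρ A, e.eval n M ρ A = g (a.eval n M ρ A) (b.eval n M ρ A))
    (ha : a.Compiles d p T) (hb : b.Compiles (d + 1) p' T') :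
    e.Compiles d (.seq p (.seq p' (.instr i))) (T + T' + 1) := by
  intro n q M ρ A s hs
  obtain ⟨s₁, t₁, e₁, h₁, m₁, r₁, v₁⟩ := ha n q M ρ A s hs
  obtain ⟨s₂, t₂, e₂, h₂, m₂, r₂, v₂⟩ := hb n q M ρ A s₁ (hs.of_eq m₁ r₁)
  refine ⟨_, _, .seq e₁ (.seq e₂ (.instr _ _)), ?_, ?_, fun r hr => ?_, ?_⟩
  · simp only [Polynomial.eval_add, Polynomial.eval_one]
    omega
  · simp (disch := omega) [hi, m₁, m₂]
  · unfold Protected at *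
    rw [hi, State.setReg_reg, if_neg (by omega), r₂ r (by omega), r₁ r hr]
  · unfold Protected at *
    rw [show 2 * (d + 1) + 3 = 2 * d + 5 by ring] at v₂
    rw [hi, State.setReg_reg, if_pos rfl, v₂, r₂ _ (by omega), v₁, he]

/-- Three doublings multiply the index by the number of arrays, and register `1` supplies the offset
behind the input. -/
theorem Expr.compiles_get {a : Expr} {d : ℕ} {p : Prog} {T : Polynomial ℕ} (k : Fin 8)
    (ha : a.Compiles d p T) :
    (Expr.get k a).Compiles d (.seq p (.seq (.instr (.add (2 * d + 3) (2 * d + 3) (2 * d + 3)))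
      (.seq (.instr (.add (2 * d + 3) (2 * d + 3) (2 * d + 3)))
      (.seq (.instr (.add (2 * d + 3) (2 * d + 3) (2 * d + 3)))
      (.seq (.instr (.const (2 * d + 5) k))
      (.seq (.instr (.add (2 * d + 3) (2 * d + 3) (2 * d + 5)))
      (.seq (.instr (.add (2 * d + 3) (2 * d + 3) 1))
      (.instr (.load (2 * d + 3) (2 * d + 3)))))))))) (T + 7) := by
  intro n q M ρ A s hs
  obtain ⟨s₁, t₁, e₁, h₁, m₁, r₁, v₁⟩ := ha n q M ρ A s hs
  have hs₁ := hs.of_eq m₁ r₁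
  refine ⟨_, _, .seq e₁ (.seq (.instr _ _) (.seq (.instr _ _) (.seq (.instr _ _)
    (.seq (.instr _ _) (.seq (.instr _ _) (.seq (.instr _ _) (.instr _ _))))))), ?_, ?_,
    fun r hr => ?_, ?_⟩
  · simp only [Polynomial.eval_add, Polynomial.eval_ofNat]
    omega
  · simp (disch := omega) [State.setReg_reg_of_ne, Instr.apply, m₁]
  · have h3 : r ≠ 2 * d + 3 := by unfold Protected at hr; omega
    have h5 : r ≠ 2 * d + 5 := by unfold Protected at hr; omega
    simp (disch := omega) [State.setReg_reg_of_ne, Instr.apply, r₁ r hr]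
  · have := hs₁.mem_arr k (a.eval n M ρ A)
    simp only [Instr.apply, State.setReg_reg, State.setReg_mem, if_true, Expr.eval, v₁,
      hs₁.reg_one, ← this]
    simp
    congr 1
    ring

/-- Cells from `q` on hold arrays, while the input is meant to be `0` there, so such reads are
intercepted: the tested value `a + 1 - q` is nonzero exactly when `a ≥ q`. -/
theorem Expr.compiles_inp {a : Expr} {d : ℕ} {p : Prog} {T : Polynomial ℕ}
    (ha : a.Compiles d p T) :
    (Expr.inp a).Compiles d (.seq p (.seq (.instr (.const (2 * d + 5) 1))
      (.seq (.instr (.add (2 * d + 5) (2 * d + 3) (2 * d + 5)))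
      (.seq (.instr (.sub (2 * d + 5) (2 * d + 5) 1))
      (.ite (2 * d + 5) (.instr (.const (2 * d + 3) 0))
        (.instr (.load (2 * d + 3) (2 * d + 3)))))))) (T + 5) := by
  intro n q M ρ A s hs
  obtain ⟨s₁, t₁, e₁, h₁, m₁, r₁, v₁⟩ := ha n q M ρ A s hs
  have hs₁ := hs.of_eq m₁ r₁
  by_cases hq : a.eval n M ρ A < q
  · refine ⟨_, _, .seq e₁ (.seq (.instr _ _) (.seq (.instr _ _) (.seq (.instr _ _)
      (.ite_false ?_ (.instr _ _))))), ?_, ?_, fun r hr => ?_, ?_⟩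
    · simp (disch := omega) [State.setReg_reg_of_ne, Instr.apply, v₁, hs₁.reg_one]
    · simp only [Polynomial.eval_add, Polynomial.eval_ofNat]
      omega
    · simp (disch := omega) [State.setReg_reg_of_ne, Instr.apply, m₁]
    · have h3 : r ≠ 2 * d + 3 ∧ r ≠ 2 * d + 5 := by unfold Protected at hr; omega
      simp (disch := omega) [State.setReg_reg_of_ne, Instr.apply, r₁ r hr]
    · simp (disch := omega) [State.setReg_reg_of_ne, Instr.apply, v₁, hs₁.mem_inp _ hq, Expr.eval]
  · refine ⟨_, _, .seq e₁ (.seq (.instr _ _) (.seq (.instr _ _) (.seq (.instr _ _)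
      (.ite_true ?_ (.instr _ _))))), ?_, ?_, fun r hr => ?_, ?_⟩
    · simp (disch := omega) [State.setReg_reg_of_ne, Instr.apply, v₁, hs₁.reg_one]
      omega
    · simp only [Polynomial.eval_add, Polynomial.eval_ofNat]
      omega
    · simp (disch := omega) [State.setReg_reg_of_ne, Instr.apply, m₁]
    · have h3 : r ≠ 2 * d + 3 ∧ r ≠ 2 * d + 5 := by unfold Protected at hr; omega
      simp (disch := omega) [State.setReg_reg_of_ne, Instr.apply, r₁ r hr]
    · simp (disch := omega) [State.setReg_reg_of_ne, Instr.apply, Expr.eval, hs₁.inp_eq_zero _ (not_lt.1 hq)]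

theorem Expr.compiles_ite {c a b : Expr} {d : ℕ} {p p' p'' : Prog} {T T' T'' : Polynomial ℕ}
    (hc : c.Compiles d p T) (ha : a.Compiles d p' T') (hb : b.Compiles d p'' T'') :
    (Expr.ite c a b).Compiles d (.seq p (.ite (2 * d + 3) p' p'')) (T + T' + T'' + 1) := by
  intro n q M ρ A s hs
  obtain ⟨s₁, t₁, e₁, h₁, m₁, r₁, v₁⟩ := hc n q M ρ A s hs
  obtain ⟨s₂, t₂, e₂, h₂, m₂, r₂, v₂⟩ := ha n q M ρ A s₁ (hs.of_eq m₁ r₁)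
  obtain ⟨s₃, t₃, e₃, h₃, m₃, r₃, v₃⟩ := hb n q M ρ A s₁ (hs.of_eq m₁ r₁)
  by_cases h : c.eval n M ρ A = 0
  · refine ⟨_, _, .seq e₁ (.ite_false (v₁.trans h) e₃), ?_, m₃.trans m₁,
      fun r hr => (r₃ r hr).trans (r₁ r hr), by simp (disch := omega) [Expr.eval, h, v₃]⟩
    simp only [Polynomial.eval_add, Polynomial.eval_one]
    omega
  · refine ⟨_, _, .seq e₁ (.ite_true (by rwa [v₁]) e₂), ?_, m₂.trans m₁,
      fun r hr => (r₂ r hr).trans (r₁ r hr), by simp (disch := omega) [Expr.eval, h, v₂]⟩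
    simp only [Polynomial.eval_add, Polynomial.eval_one]
    omega

/-- Four registers are in use during the loop: the partial sum, the countdown, the saved value of
the bound variable, and the constant `1`. The body runs at level `d + 4` so as not to touch them. -/
theorem Expr.compiles_sum {a : Expr} {d : ℕ} {p : Prog} {T : Polynomial ℕ} (x : ℕ)
    (ha : a.Compiles (d + 4) p T) :
    (Expr.sum x a).Compiles d (.seq (.instr (.const (2 * d + 3) 0))
      (.seq (.instr (.copy (2 * d + 5) 0))
      (.seq (.instr (.copy (2 * d + 7) (2 * x + 2)))
      (.seq (.instr (.const (2 * x + 2) 0))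
      (.seq (.instr (.const (2 * d + 9) 1))
      (.seq (.loop (2 * d + 5) (.seq p
        (.seq (.instr (.add (2 * d + 3) (2 * d + 3) (2 * d + 11)))
        (.seq (.instr (.add (2 * x + 2) (2 * x + 2) (2 * d + 9)))
        (.instr (.sub (2 * d + 5) (2 * d + 5) (2 * d + 9)))))))
      (.instr (.copy (2 * x + 2) (2 * d + 7))))))))) (.X * (T + 4) + 7) := by
  intro n q M ρ A s hs
  let P : ℕ → State → Prop := fun k s' => s'.mem = s.mem ∧
    (∀ r, Protected d r → r ≠ 2 * x + 2 → s'.reg r = s.reg r) ∧ s'.reg (2 * x + 2) = k ∧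
    s'.reg (2 * d + 3) = ∑ v ∈ Finset.range k, a.eval n M (Function.update ρ x v) A ∧
    s'.reg (2 * d + 5) = n - k ∧ s'.reg (2 * d + 7) = ρ x ∧ s'.reg (2 * d + 9) = 1
  have hstep : ∀ k < n, ∀ s₀, P k s₀ → ∃ s' t, Exec (.seq p
        (.seq (.instr (.add (2 * d + 3) (2 * d + 3) (2 * d + 11)))
        (.seq (.instr (.add (2 * x + 2) (2 * x + 2) (2 * d + 9)))
        (.instr (.sub (2 * d + 5) (2 * d + 5) (2 * d + 9)))))) s₀ s' t ∧
        t ≤ T.eval n + 3 ∧ P (k + 1) s' := by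
    rintro k - s₀ ⟨hm, hr, hx, h3, h5, h7, h9⟩
    have hs₀ : Represents n q M (Function.update ρ x k) A s₀ := by
      refine ⟨?_, ?_, fun y => ?_, by rw [hm]; exact hs.mem_inp, hs.inp_eq_zero,
        by rw [hm]; exact hs.mem_arr⟩
      · rw [hr 0 (Or.inr rfl) (by omega), hs.reg_zero]
      · rw [hr 1 (Or.inl (by omega)) (by omega), hs.reg_one]
      · by_cases hy : y = x
        · rw [hy, Function.update_self, hx]
        · rw [Function.update_of_ne hy, hr _ (Or.inr (by omega)) (by omega), hs.reg_var]
    obtain ⟨s₁, t₁, e₁, h₁, m₁, r₁, v₁⟩ := ha n q M _ A s₀ hs₀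
    unfold Protected at r₁
    rw [show 2 * (d + 4) + 3 = 2 * d + 11 by ring] at v₁ r₁
    refine ⟨_, _, .seq e₁ (.seq (.instr _ _) (.seq (.instr _ _) (.instr _ _))), by omega,
      ?_, ?_, ?_, ?_, ?_, ?_, ?_⟩
    · simp (disch := omega) [State.setReg_reg_of_ne, Instr.apply, m₁, hm]
    · intro r hrp hrx
      have h3 : r ≠ 2 * d + 3 := by unfold Protected at hrp; omega
      have h5 : r ≠ 2 * d + 5 := by unfold Protected at hrp; omega
      simp only [Instr.apply, State.setReg_reg, h3, h5, hrx, if_false]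
      rw [r₁ r (by unfold Protected at hrp; omega), hr r hrp hrx]
    · simp (disch := omega) [State.setReg_reg_of_ne, Instr.apply, r₁ (2 * x + 2) (by omega), hx, r₁ (2 * d + 9) (by omega), h9]
    · simp (disch := omega) [State.setReg_reg_of_ne, Instr.apply, r₁ (2 * d + 3) (by omega), h3, v₁, Finset.sum_range_succ]
    · have h2' : 2 * d + 9 ≠ 2 * x + 2 := by omega
      simp (disch := omega) [State.setReg_reg_of_ne, Instr.apply, r₁ (2 * d + 5) (by omega), h5, r₁ (2 * d + 9) (by omega), h9]
      omega
    · simp (disch := omega) [State.setReg_reg_of_ne, Instr.apply, r₁ (2 * d + 7) (by omega), h7]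
    · simp (disch := omega) [State.setReg_reg_of_ne, Instr.apply, r₁ (2 * d + 9) (by omega), h9]
  have h₀ : P 0 (((((s.setReg (2 * d + 3) 0).setReg (2 * d + 5) n).setReg (2 * d + 7)
      (ρ x)).setReg (2 * x + 2) 0).setReg (2 * d + 9) 1) := by
    refine ⟨rfl, ?_, ?_, ?_, ?_, ?_, ?_⟩
    · intro r hrp hrx
      have h3 : r ≠ 2 * d + 3 ∧ r ≠ 2 * d + 5 ∧ r ≠ 2 * d + 7 ∧ r ≠ 2 * d + 9 := by
        unfold Protected at hrp; omega
      simp (disch := omega) [State.setReg_reg_of_ne]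
    · simp (disch := omega) [State.setReg_reg_of_ne]
    · simp (disch := omega) [State.setReg_reg_of_ne]
    · simp (disch := omega) [State.setReg_reg_of_ne]
    · simp (disch := omega) [State.setReg_reg_of_ne]
    · simp
  obtain ⟨s₂, t₂, e₂, h₂, m₂, r₂, hx₂, h3, h5, h7, h9⟩ :=
    Exec.exists_loop P (fun k s h => h.2.2.2.2.1) hstep h₀
  have e₁ : Exec _ s _ _ := .seq (.instr (.const (2 * d + 3) 0) _)
    (.seq (.instr (.copy (2 * d + 5) 0) _) (.seq (.instr (.copy (2 * d + 7) (2 * x + 2)) _)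
    (.seq (.instr (.const (2 * x + 2) 0) _) (.seq (.instr (.const (2 * d + 9) 1) _)
    (.seq (show Exec _ _ s₂ t₂ by
      convert e₂ using 1
      simp (disch := omega) [State.setReg_reg_of_ne, Instr.apply, hs.reg_zero, hs.reg_var])
      (.instr (.copy (2 * x + 2) (2 * d + 7)) _))))))
  refine ⟨_, _, e₁, ?_, m₂, fun r hr => ?_, ?_⟩
  · simp only [Polynomial.eval_add, Polynomial.eval_mul, Polynomial.eval_X, Polynomial.eval_ofNat]
    have : T.eval n + 3 + 1 = T.eval n + 4 := by ring
    rw [this] at h₂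
    omega
  · by_cases hrx : r = 2 * x + 2
    · simp (disch := omega) [Instr.apply, hrx, h7, hs.reg_var]
    · simp (disch := omega) [State.setReg_reg_of_ne, Instr.apply, r₂ r hr hrx]
  · simp (disch := omega) [State.setReg_reg_of_ne, Instr.apply, h3, Expr.eval]

theorem Expr.exists_compiles (e : Expr) : ∀ d, ∃ p T, e.Compiles d p T := by
  induction e with
  | size =>
    exact fun d => ⟨_, _, compiles_of_instr (.copy (2 * d + 3) 0) (fun s => s.reg 0)
      (fun s => rfl) fun n q M ρ A s hs => hs.reg_zero⟩
  | const c =>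
    exact fun d => ⟨_, _, compiles_of_instr (.const (2 * d + 3) c) (fun _ => c)
      (fun s => rfl) fun n q M ρ A s hs => rfl⟩
  | var x =>
    exact fun d => ⟨_, _, compiles_of_instr (.copy (2 * d + 3) (2 * x + 2))
      (fun s => s.reg (2 * x + 2)) (fun s => rfl) fun n q M ρ A s hs => hs.reg_var x⟩
  | add a b iha ihb =>
    intro d
    obtain ⟨p, T, h⟩ := iha d
    obtain ⟨p', T', h'⟩ := ihb (d + 1)
    exact ⟨_, _, compiles_binary (.add (2 * d + 3) (2 * d + 3) (2 * d + 5)) (· + ·)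
      (fun s => rfl) (fun _ _ _ _ => rfl) h h'⟩
  | sub a b iha ihb =>
    intro d
    obtain ⟨p, T, h⟩ := iha d
    obtain ⟨p', T', h'⟩ := ihb (d + 1)
    exact ⟨_, _, compiles_binary (.sub (2 * d + 3) (2 * d + 3) (2 * d + 5)) (· - ·)
      (fun s => rfl) (fun _ _ _ _ => rfl) h h'⟩
  | get k i ih =>
    intro d
    obtain ⟨p, T, h⟩ := ih d
    exact ⟨_, _, compiles_get k h⟩
  | inp i ih =>
    intro d
    obtain ⟨p, T, h⟩ := ih d
    exact ⟨_, _, compiles_inp h⟩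
  | ite c a b ihc iha ihb =>
    intro d
    obtain ⟨p, T, h⟩ := ihc d
    obtain ⟨p', T', h'⟩ := iha d
    obtain ⟨p'', T'', h''⟩ := ihb d
    exact ⟨_, _, compiles_ite h h' h''⟩
  | sum x a ih =>
    intro d
    obtain ⟨p, T, h⟩ := ih (d + 4)
    exact ⟨_, _, compiles_sum x h⟩

/-- `p` runs the command `c` with intermediate results at level `d` or above, in time `T`. -/
def Cmd.Compiles (c : Cmd) (d : ℕ) (p : Prog) (T : Polynomial ℕ) : Prop :=
  ∀ n q M ρ A s, Represents n q M ρ A s → ∃ s' t, Exec p s s' t ∧ t ≤ T.eval n ∧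
    Represents n q M ρ (c.run n M ρ A) s' ∧ ∀ r < 2 * d + 3, s'.reg r = s.reg r

theorem Cmd.compiles_set {i a : Expr} {d : ℕ} {p p' : Prog} {T T' : Polynomial ℕ} (k : Fin 8)
    (hi : i.Compiles d p T) (ha : a.Compiles (d + 1) p' T') :
    (Cmd.set k i a).Compiles d (.seq p (.seq p'
      (.seq (.instr (.add (2 * d + 3) (2 * d + 3) (2 * d + 3)))
      (.seq (.instr (.add (2 * d + 3) (2 * d + 3) (2 * d + 3)))
      (.seq (.instr (.add (2 * d + 3) (2 * d + 3) (2 * d + 3)))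
      (.seq (.instr (.const (2 * d + 7) k))
      (.seq (.instr (.add (2 * d + 3) (2 * d + 3) (2 * d + 7)))
      (.seq (.instr (.add (2 * d + 3) (2 * d + 3) 1))
      (.instr (.store (2 * d + 3) (2 * d + 5))))))))))) (T + T' + 7) := by
  intro n q M ρ A s hs
  obtain ⟨s₁, t₁, e₁, h₁, m₁, r₁, v₁⟩ := hi n q M ρ A s hs
  have hs₁ := hs.of_eq m₁ r₁
  obtain ⟨s₂, t₂, e₂, h₂, m₂, r₂, v₂⟩ := ha n q M ρ A s₁ hs₁
  have hs₂ := hs₁.of_eq m₂ r₂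
  have v₁' : s₂.reg (2 * d + 3) = i.eval n M ρ A := by
    rw [r₂ _ (Or.inl (by omega)), v₁]
  rw [show 2 * (d + 1) + 3 = 2 * d + 5 by ring] at v₂
  have key : ∀ r, r ≠ 2 * d + 3 → r ≠ 2 * d + 7 → (Instr.apply (.store (2 * d + 3) (2 * d + 5))
      (Instr.apply (.add (2 * d + 3) (2 * d + 3) 1)
      (Instr.apply (.add (2 * d + 3) (2 * d + 3) (2 * d + 7))
      (Instr.apply (.const (2 * d + 7) k)
      (Instr.apply (.add (2 * d + 3) (2 * d + 3) (2 * d + 3))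
      (Instr.apply (.add (2 * d + 3) (2 * d + 3) (2 * d + 3))
      (Instr.apply (.add (2 * d + 3) (2 * d + 3) (2 * d + 3)) s₂))))))).reg r = s₂.reg r := by
    intro r h3 h7
    simp (disch := omega) [State.setReg_reg_of_ne, Instr.apply]
  have hmem : ∀ b, (Instr.apply (.store (2 * d + 3) (2 * d + 5))
      (Instr.apply (.add (2 * d + 3) (2 * d + 3) 1)
      (Instr.apply (.add (2 * d + 3) (2 * d + 3) (2 * d + 7))
      (Instr.apply (.const (2 * d + 7) k)
      (Instr.apply (.add (2 * d + 3) (2 * d + 3) (2 * d + 3))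
      (Instr.apply (.add (2 * d + 3) (2 * d + 3) (2 * d + 3))
      (Instr.apply (.add (2 * d + 3) (2 * d + 3) (2 * d + 3)) s₂))))))).mem b =
      if b = 8 * i.eval n M ρ A + k + q then a.eval n M ρ A else s₂.mem b := by
    intro b
    simp only [Instr.apply, State.setMem_mem, State.setReg_reg, State.setReg_mem]
    simp (disch := omega) [v₁', v₂, hs₂.reg_one]
    congr 2
    ring_nf
  refine ⟨_, _, .seq e₁ (.seq e₂ (.seq (.instr _ _) (.seq (.instr _ _) (.seq (.instr _ _)
    (.seq (.instr _ _) (.seq (.instr _ _) (.seq (.instr _ _) (.instr _ _)))))))), ?_, ?_, ?_⟩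
  · simp only [Polynomial.eval_add, Polynomial.eval_ofNat]
    omega
  · refine ⟨?_, ?_, fun x => ?_, fun b hb => ?_, hs.inp_eq_zero, fun k' i' => ?_⟩
    · rw [key _ (by omega) (by omega), hs₂.reg_zero]
    · rw [key _ (by omega) (by omega), hs₂.reg_one]
    · rw [key _ (by omega) (by omega), hs₂.reg_var]
    · rw [hmem, if_neg (by omega), hs₂.mem_inp b hb]
    · rw [hmem, Cmd.run]
      by_cases hk : k' = k
      · subst hk
        rw [Function.update_self]
        by_cases hi' : i' = i.eval n M ρ A
        · rw [hi', Function.update_self, if_pos rfl]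
        · rw [Function.update_of_ne hi', if_neg (by omega), hs₂.mem_arr]
      -- Cells of different arrays differ modulo `8` after subtracting the offset.
      · have := Fin.val_ne_of_ne hk
        rw [Function.update_of_ne hk, if_neg (by omega), hs₂.mem_arr]
  · intro r hr
    rw [key _ (by omega) (by omega), r₂ r (Or.inl (by omega)), r₁ r (Or.inl hr)]

theorem Cmd.compiles_seq {c c' : Cmd} {d : ℕ} {p p' : Prog} {T T' : Polynomial ℕ}
    (h : c.Compiles d p T) (h' : c'.Compiles d p' T') :
    (Cmd.seq c c').Compiles d (.seq p p') (T + T') := by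
  intro n q M ρ A s hs
  obtain ⟨s₁, t₁, e₁, h₁, hs₁, r₁⟩ := h n q M ρ A s hs
  obtain ⟨s₂, t₂, e₂, h₂, hs₂, r₂⟩ := h' n q M ρ _ s₁ hs₁
  refine ⟨s₂, _, .seq e₁ e₂, ?_, hs₂, fun r hr => (r₂ r hr).trans (r₁ r hr)⟩
  rw [Polynomial.eval_add]
  omega

/-- The machine has no empty program, so copying register `0` to itself serves as one. -/
theorem Cmd.compiles_when {e : Expr} {c : Cmd} {d : ℕ} {p p' : Prog} {T T' : Polynomial ℕ}
    (he : e.Compiles d p T) (h : c.Compiles d p' T') :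
    (Cmd.when e c).Compiles d (.seq p (.ite (2 * d + 3) p' (.instr (.copy 0 0))))
      (T + T' + 2) := by
  intro n q M ρ A s hs
  obtain ⟨s₁, t₁, e₁, h₁, m₁, r₁, v₁⟩ := he n q M ρ A s hs
  have hs₁ := hs.of_eq m₁ r₁
  obtain ⟨s₂, t₂, e₂, h₂, hs₂, r₂⟩ := h n q M ρ A s₁ hs₁
  by_cases h : e.eval n M ρ A = 0
  · have hcopy : Exec (.instr (.copy 0 0)) s₁ s₁ 1 := by
      have := Exec.instr (.copy 0 0) s₁
      simpa [Instr.apply, State.setReg] using this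
    refine ⟨s₁, _, .seq e₁ (.ite_false (v₁.trans h) hcopy), ?_,
      by simpa [Cmd.run, h] using hs₁, fun r hr => r₁ r (Or.inl hr)⟩
    simp only [Polynomial.eval_add, Polynomial.eval_ofNat]
    omega
  · refine ⟨s₂, _, .seq e₁ (.ite_true (by rwa [v₁]) e₂), ?_, by simpa [Cmd.run, h] using hs₂,
      fun r hr => (r₂ r hr).trans (r₁ r (Or.inl hr))⟩
    simp only [Polynomial.eval_add, Polynomial.eval_ofNat]
    omega

/-- Here only three registers have to survive the body: countdown, saved variable and the constant
`1`. -/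
theorem Cmd.compiles_loop {c : Cmd} {d : ℕ} {p : Prog} {T : Polynomial ℕ} (x : ℕ)
    (hc : c.Compiles (d + 3) p T) :
    (Cmd.loop x c).Compiles d (.seq (.instr (.copy (2 * d + 3) 0))
      (.seq (.instr (.copy (2 * d + 5) (2 * x + 2)))
      (.seq (.instr (.const (2 * x + 2) 0))
      (.seq (.instr (.const (2 * d + 7) 1))
      (.seq (.loop (2 * d + 3) (.seq p
        (.seq (.instr (.add (2 * x + 2) (2 * x + 2) (2 * d + 7)))
        (.instr (.sub (2 * d + 3) (2 * d + 3) (2 * d + 7))))))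
      (.instr (.copy (2 * x + 2) (2 * d + 5)))))))) (.X * (T + 3) + 6) := by
  intro n q M ρ A s hs
  let P : ℕ → State → Prop := fun k s' =>
    Represents n q M (Function.update ρ x k)
      (iter (fun v A => c.run n M (Function.update ρ x v) A) k A) s' ∧
    (∀ r < 2 * d + 3, r ≠ 2 * x + 2 → s'.reg r = s.reg r) ∧
    s'.reg (2 * d + 3) = n - k ∧ s'.reg (2 * d + 5) = ρ x ∧ s'.reg (2 * d + 7) = 1
  have hstep : ∀ k < n, ∀ s₀, P k s₀ → ∃ s' t, Exec (.seq p
        (.seq (.instr (.add (2 * x + 2) (2 * x + 2) (2 * d + 7)))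
        (.instr (.sub (2 * d + 3) (2 * d + 3) (2 * d + 7))))) s₀ s' t ∧
        t ≤ T.eval n + 2 ∧ P (k + 1) s' := by
    rintro k - s₀ ⟨hs₀, hr, h3, h5, h7⟩
    obtain ⟨s₁, t₁, e₁, h₁, hs₁, r₁⟩ := hc n q M _ _ s₀ hs₀
    refine ⟨_, _, .seq e₁ (.seq (.instr _ _) (.instr _ _)), by omega,
      ⟨?_, ?_, fun y => ?_, hs₁.mem_inp, hs.inp_eq_zero, hs₁.mem_arr⟩, ?_, ?_, ?_, ?_⟩
    · simp (disch := omega) [State.setReg_reg_of_ne, Instr.apply, hs₁.reg_zero]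
    · simp (disch := omega) [State.setReg_reg_of_ne, Instr.apply, hs₁.reg_one]
    · have h2 := hs₁.reg_var y
      by_cases hy : y = x
      · subst hy
        rw [Function.update_self] at h2
        simp (disch := omega) [State.setReg_reg_of_ne, Instr.apply, h2, r₁ (2 * d + 7) (by omega), h7]
      · rw [Function.update_of_ne hy] at h2
        simp (disch := omega) [State.setReg_reg_of_ne, Instr.apply, h2]
    · intro r hrd hrx
      simp (disch := omega) [State.setReg_reg_of_ne, Instr.apply, r₁ r (by omega), hr r hrd hrx]
    · simp (disch := omega) [State.setReg_reg_of_ne, Instr.apply, r₁ (2 * d + 3) (by omega), r₁ (2 * d + 7) (by omega), h3, h7]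
      omega
    · simp (disch := omega) [State.setReg_reg_of_ne, Instr.apply, r₁ (2 * d + 5) (by omega), h5]
    · simp (disch := omega) [State.setReg_reg_of_ne, Instr.apply, r₁ (2 * d + 7) (by omega), h7]
  have h₀ : P 0 ((((s.setReg (2 * d + 3) n).setReg (2 * d + 5)
      (ρ x)).setReg (2 * x + 2) 0).setReg (2 * d + 7) 1) := by
    refine ⟨⟨?_, ?_, fun y => ?_, hs.mem_inp, hs.inp_eq_zero, hs.mem_arr⟩, ?_, ?_, ?_, ?_⟩
    · simp (disch := omega) [State.setReg_reg_of_ne, hs.reg_zero]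
    · simp (disch := omega) [State.setReg_reg_of_ne, hs.reg_one]
    · by_cases hy : y = x
      · subst hy
        simp (disch := omega) [State.setReg_reg_of_ne]
      · simp (disch := omega) [State.setReg_reg_of_ne, hs.reg_var]
    · intro r hrd hrx
      have h2 : r ≠ 2 * d + 5 := by omega
      have h3 : r ≠ 2 * d + 7 := by omega
      simp (disch := omega) [State.setReg_reg_of_ne]
    · simp (disch := omega) [State.setReg_reg_of_ne]
    · simp (disch := omega) [State.setReg_reg_of_ne]
    · simp
  obtain ⟨s₂, t₂, e₂, h₂, hs₂, r₂, h3, h5, h7⟩ :=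
    Exec.exists_loop P (fun k s h => h.2.2.1) hstep h₀
  have e₁ : Exec _ s _ _ := .seq (.instr (.copy (2 * d + 3) 0) _)
    (.seq (.instr (.copy (2 * d + 5) (2 * x + 2)) _)
    (.seq (.instr (.const (2 * x + 2) 0) _) (.seq (.instr (.const (2 * d + 7) 1) _)
    (.seq (show Exec _ _ s₂ t₂ by
      convert e₂ using 1
      simp (disch := omega) [State.setReg_reg_of_ne, Instr.apply, hs.reg_zero, hs.reg_var])
      (.instr (.copy (2 * x + 2) (2 * d + 5)) _)))))
  refine ⟨_, _, e₁, ?_, ⟨?_, ?_, fun y => ?_, hs₂.mem_inp, hs.inp_eq_zero, hs₂.mem_arr⟩,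
    fun r hr => ?_⟩
  · simp only [Polynomial.eval_add, Polynomial.eval_mul, Polynomial.eval_X, Polynomial.eval_ofNat]
    have : T.eval n + 2 + 1 = T.eval n + 3 := by ring
    rw [this] at h₂
    omega
  · simp (disch := omega) [State.setReg_reg_of_ne, Instr.apply, hs₂.reg_zero]
  · simp (disch := omega) [State.setReg_reg_of_ne, Instr.apply, hs₂.reg_one]
  · by_cases hy : y = x
    · simp (disch := omega) [Instr.apply, hy, h5]
    · have := hs₂.reg_var y
      rw [Function.update_of_ne hy] at this
      simp (disch := omega) [State.setReg_reg_of_ne, Instr.apply, this]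
  · by_cases hrx : r = 2 * x + 2
    · simp (disch := omega) [Instr.apply, hrx, h5, hs.reg_var]
    · simp (disch := omega) [State.setReg_reg_of_ne, Instr.apply, r₂ r hr hrx]

theorem Cmd.exists_compiles (c : Cmd) : ∀ d, ∃ p T, c.Compiles d p T := by
  induction c with
  | set k i a =>
    intro d
    obtain ⟨p, T, h⟩ := i.exists_compiles d
    obtain ⟨p', T', h'⟩ := a.exists_compiles (d + 1)
    exact ⟨_, _, compiles_set k h h'⟩
  | seq c c' ih ih' =>
    intro d
    obtain ⟨p, T, h⟩ := ih d
    obtain ⟨p', T', h'⟩ := ih' d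
    exact ⟨_, _, compiles_seq h h'⟩
  | when e c ih =>
    intro d
    obtain ⟨p, T, h⟩ := e.exists_compiles d
    obtain ⟨p', T', h'⟩ := ih d
    exact ⟨_, _, compiles_when h h'⟩
  | loop x c ih =>
    intro d
    obtain ⟨p, T, h⟩ := ih (d + 3)
    exact ⟨_, _, compiles_loop x h⟩

/-- The preparation of the initial state computes the square of the input size. -/
theorem exists_represents_graphInput : ∃ (p : Prog) (T : Polynomial ℕ), ∀ (n : ℕ)
    (G : SimpleGraph (Fin n)), ∃ s t, Exec p (graphInput G) s t ∧ t ≤ T.eval n ∧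
      Represents n (n * n) (graphInput G).mem (fun _ => 0) (fun _ _ => 0) s := by
  -- Multiplication is repeated addition: register `1` receives `n` as often as register `3` counts
  -- down.
  refine ⟨.seq (.instr (.copy 3 0)) (.seq (.instr (.const 5 1))
    (.loop 3 (.seq (.instr (.add 1 1 0)) (.instr (.sub 3 3 5))))), .X * 3 + 3, fun n G => ?_⟩
  have hzero : ∀ a, n * n ≤ a → (graphInput G).mem a = 0 := by
    intro a ha
    refine if_neg ?_
    rintro ⟨i, j, rfl, -⟩
    have : n * i + j < n * n := by
      calc n * (i : ℕ) + j < n * i + n := by omega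
        _ = n * (i + 1) := by ring
        _ ≤ n * n := Nat.mul_le_mul_left n i.2
    omega
  let P : ℕ → State → Prop := fun k s => s.mem = (graphInput G).mem ∧ s.reg 0 = n ∧
    s.reg 1 = k * n ∧ s.reg 3 = n - k ∧ s.reg 5 = 1 ∧ ∀ x, s.reg (2 * x + 2) = 0
  have hstep : ∀ k < n, ∀ s, P k s → ∃ s' t,
      Exec (.seq (.instr (.add 1 1 0)) (.instr (.sub 3 3 5))) s s' t ∧ t ≤ 2 ∧ P (k + 1) s' := by
    rintro k - s ⟨hm, h0, h1, h3, h5, hx⟩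
    refine ⟨_, _, .seq (.instr _ _) (.instr _ _), le_rfl, hm, ?_, ?_, ?_, ?_, fun x => ?_⟩
    · simp (disch := omega) [State.setReg_reg_of_ne, Instr.apply, h0]
    · simp (disch := omega) [State.setReg_reg_of_ne, Instr.apply, h0, h1]
      ring
    · simp (disch := omega) [State.setReg_reg_of_ne, Instr.apply, h3, h5]
      omega
    · simp (disch := omega) [State.setReg_reg_of_ne, Instr.apply, h5]
    · simp (disch := omega) [State.setReg_reg_of_ne, Instr.apply, hx]
  have h₀ : P 0 (((graphInput G).setReg 3 n).setReg 5 1) := by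
    refine ⟨rfl, ?_, ?_, ?_, ?_, fun x => ?_⟩
    · simp (disch := omega) [State.setReg_reg_of_ne, graphInput]
    · simp (disch := omega) [State.setReg_reg_of_ne, graphInput]
    · simp (disch := omega) [State.setReg_reg_of_ne]
    · simp
    · have e5 : 2 * x + 2 ≠ 5 := by omega
      simp (disch := omega) [State.setReg_reg_of_ne, graphInput]
  obtain ⟨s, t, he, ht, hm, h0, h1, -, -, hx⟩ :=
    Exec.exists_loop P (fun k s h => h.2.2.2.1) hstep h₀
  refine ⟨s, 1 + (1 + t), .seq (.instr _ _) (.seq (.instr _ _) ?_), ?_, h0, h1, hx,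
    fun a _ => by rw [hm], hzero, fun k i => ?_⟩
  · convert he using 1
    simp [Instr.apply, graphInput]
  · simp only [Polynomial.eval_add, Polynomial.eval_mul, Polynomial.eval_X, Polynomial.eval_ofNat]
    omega
  · rw [hm, hzero _ (by omega)]

/-- A function that is computed by a command and an expression takes polynomial time. -/
theorem polyTimeOnGraphs_of_cmd {C : ∀ {n : ℕ}, SimpleGraph (Fin n) → Prop}
    {f : ∀ {n : ℕ}, SimpleGraph (Fin n) → ℕ} (c : Cmd) (e : Expr)
    (h : ∀ (n : ℕ) (G : SimpleGraph (Fin n)), C G →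
      e.eval n (graphInput G).mem (fun _ => 0)
        (c.run n (graphInput G).mem (fun _ => 0) (fun _ _ => 0)) = f G) :
    PolyTimeOnGraphs C f := by
  obtain ⟨p₁, T₁, h₁⟩ := exists_represents_graphInput
  obtain ⟨p₂, T₂, h₂⟩ := c.exists_compiles 0
  obtain ⟨p₃, T₃, h₃⟩ := e.exists_compiles 0
  refine ⟨.seq p₁ (.seq p₂ (.seq p₃ (.instr (.copy 0 3)))), T₁ + T₂ + T₃ + 1, fun n G hG => ?_⟩
  obtain ⟨s₁, t₁, e₁, b₁, hs₁⟩ := h₁ n G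
  obtain ⟨s₂, t₂, e₂, b₂, hs₂, -⟩ := h₂ _ _ _ _ _ s₁ hs₁
  obtain ⟨s₃, t₃, e₃, b₃, -, -, v₃⟩ := h₃ _ _ _ _ _ s₂ hs₂
  refine ⟨_, _, .seq e₁ (.seq e₂ (.seq e₃ (.instr _ _))), ?_, ?_⟩
  · refine Eq.trans ?_ (v₃.trans (h n G hG))
    simp [Instr.apply]
  · simp only [Polynomial.eval_add, Polynomial.eval_one]
    omega

end RAM

namespace RAM

/-! ### Saturation -/

section iter

variable {α : Type*} {Inv : α → Prop} {m : α → ℕ}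

/-- Without progress, every step of the round was tested in the same unchanged state `a`, so the
failures `Q k` all refer to that state. -/
theorem iter_progress {f : ℕ → α → α} {Q : ℕ → α → Prop} {n : ℕ}
    (h : ∀ k < n, ∀ a, Inv a → Inv (f k a) ∧ (m a < m (f k a) ∨ f k a = a ∧ Q k a)) {a : α}
    (ha : Inv a) :
    Inv (iter f n a) ∧ (m a < m (iter f n a) ∨ iter f n a = a ∧ ∀ k < n, Q k a) := by
  induction n with
  | zero => exact ⟨ha, Or.inr ⟨rfl, fun k hk => absurd hk (Nat.not_lt_zero k)⟩⟩
  | succ n ih =>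
    obtain ⟨h1, h2⟩ := ih fun k hk => h k (by omega)
    obtain ⟨h3, h4⟩ := h n n.lt_succ_self _ h1
    refine ⟨h3, ?_⟩
    change m a < m (f n (iter f n a)) ∨ f n (iter f n a) = a ∧ _
    rcases h2 with h2 | ⟨h2, h5⟩
    · rcases h4 with h4 | ⟨h4, -⟩
      · exact Or.inl (h2.trans h4)
      · rw [h4]; exact Or.inl h2
    · rw [h2] at h4 ⊢
      refine h4.imp id fun h4 => ⟨h4.1, fun k hk => ?_⟩
      rcases Nat.lt_succ_iff_lt_or_eq.1 hk with hk | rfl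
      · exact h5 k hk
      · exact h4.2

theorem iter_fixed {g : α → α} {a : α} (h : g a = a) (t : ℕ) : iter (fun _ => g) t a = a := by
  induction t with
  | zero => rfl
  | succ t ih =>
    change g (iter (fun _ => g) t a) = a
    rw [ih, h]

/-- Each round gains at least `s` until the process is stuck, and a stuck state persists. Having `s`
as a parameter allows the lemma to be nested. -/
theorem iter_repeat {g : α → α} {Stuck : α → Prop} {s : ℕ}
    (h : ∀ a, Inv a → Inv (g a) ∧ (m a + s ≤ m (g a) ∨ Stuck (g a)))
    (hs : ∀ a, Stuck a → g a = a) (t : ℕ) {a : α} (ha : Inv a) :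
    Inv (iter (fun _ => g) t a) ∧
      (m a + t * s ≤ m (iter (fun _ => g) t a) ∨ Stuck (iter (fun _ => g) t a)) := by
  induction t with
  | zero => exact ⟨ha, Or.inl (by simp [iter])⟩
  | succ t ih =>
    obtain ⟨h1, h2⟩ := ih
    obtain ⟨h3, h4⟩ := h _ h1
    refine ⟨h3, ?_⟩
    change m a + (t + 1) * s ≤ m (g (iter (fun _ => g) t a)) ∨ Stuck (g (iter (fun _ => g) t a))
    rcases h2 with h2 | h2
    · refine h4.imp (fun h4 => ?_) id
      rw [Nat.succ_mul]
      omega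
    · rw [hs _ h2]
      exact Or.inr h2

/-- Conditional updates that increase a quantity bounded by `n * n` come to a halt after `n * n`
passes over all pairs of indices below `n`. -/
theorem iter_saturate {c : ℕ → ℕ → α → Prop} [∀ i j a, Decidable (c i j a)]
    {u : ℕ → ℕ → α → α} {n : ℕ}
    (hu : ∀ i < n, ∀ j < n, ∀ a, Inv a → c i j a → Inv (u i j a) ∧ m a < m (u i j a))
    (hm : ∀ a, Inv a → m a ≤ n * n) {a : α} (ha : Inv a) {b : α}
    (hb : b = iter (fun _ => iter (fun _ => iter (fun i => iter (fun j a =>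
      if c i j a then u i j a else a) n) n) n) n a) :
    Inv b ∧ ∀ i < n, ∀ j < n, ¬ c i j b := by
  set pass : α → α := iter (fun i => iter (fun j a => if c i j a then u i j a else a) n) n
    with hpass
  let Stuck : α → Prop := fun a => pass a = a ∧ ∀ i < n, ∀ j < n, ¬ c i j a
  have h1 : ∀ a, Inv a → Inv (pass a) ∧ (m a < m (pass a) ∨ pass a = a ∧
      ∀ i < n, ∀ j < n, ¬ c i j a) := fun a ha =>
    iter_progress (Q := fun i a => ∀ j < n, ¬ c i j a) (fun i hi a ha =>
      iter_progress (Q := fun j a => ¬ c i j a) (fun j hj a ha => by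
        by_cases h : c i j a
        · simpa [h] using hu i hi j hj a ha h
        · simpa [h] using ha) ha) ha
  have h2 : ∀ a, Inv a → Inv (pass a) ∧ (m a + 1 ≤ m (pass a) ∨ Stuck (pass a)) := fun a ha =>
    ⟨(h1 a ha).1, (h1 a ha).2.imp id fun h => by
      change pass (pass a) = pass a ∧ _
      rw [h.1]
      exact h⟩
  -- Passes gaining `1` give blocks of `n` passes gaining `n`, and `n` blocks gain `n * n`. A
  -- further admissible update would then exceed the bound on `m`.
  have h3 := fun a ha => iter_repeat h2 (fun a h => h.1) n (a := a) ha
  have h4 := iter_repeat h3 (fun a h => iter_fixed h.1 n) n ha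
  rw [← hb] at h4
  refine ⟨h4.1, fun i hi j hj hc => ?_⟩
  rcases h4.2 with h | h
  · have h5 := hu i hi j hj b h4.1 hc
    have h6 := hm _ h5.1
    rw [mul_one] at h
    omega
  · exact h.2 i hi j hj hc

end iter

/-! ### Bipartite matching by an auction -/

/-- The invariant of the auction: column `j < n` has price `p j`, and `o j` is `0` or the
successor of the row that owns it. -/
structure Auction (R : ℕ → ℕ → Prop) (n : ℕ) (p o : ℕ → ℕ) : Prop where
  owner : ∀ j < n, o j ≠ 0 → ∃ i < n, o j = i + 1 ∧ R i j
  inj : ∀ j < n, ∀ j' < n, o j ≠ 0 → o j = o j' → j = j'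
  pos : ∀ j < n, 0 < p j → o j ≠ 0
  le_add_one : ∀ j < n, ∀ i, o j = i + 1 → ∀ j' < n, R i j' → p j ≤ p j' + 1
  le : ∀ j < n, p j ≤ n

/-- Row `i` may bid for column `j`. -/
def Bids (R : ℕ → ℕ → Prop) (n : ℕ) (p o : ℕ → ℕ) (i j : ℕ) : Prop :=
  R i j ∧ p j < n ∧ (∀ j' < n, o j' ≠ i + 1) ∧ ∀ j' < n, ¬ (R i j' ∧ p j' < p j)

variable {R : ℕ → ℕ → Prop} {n : ℕ} {p o : ℕ → ℕ}

theorem Auction.zero (R : ℕ → ℕ → Prop) {n : ℕ} {p o : ℕ → ℕ} (hp : ∀ j < n, p j = 0)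
    (ho : ∀ j < n, o j = 0) : Auction R n p o where
  owner j hj h := absurd (ho j hj) h
  inj j hj _ _ h := absurd (ho j hj) h
  pos j hj h := absurd (hp j hj) h.ne'
  le_add_one j hj i h := by rw [ho j hj] at h; omega
  le j hj := by rw [hp j hj]; omega

/-- The bidder takes a cheapest adjacent column and raises its price by one, so it pays at most one
more than for any alternative; later bids only make alternatives dearer. A previous owner is
overwritten and becomes free to bid again. -/
theorem Auction.bid (h : Auction R n p o) {i j : ℕ} (hi : i < n)
    (hb : Bids R n p o i j) :
    Auction R n (Function.update p j (p j + 1)) (Function.update o j (i + 1)) := by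
  obtain ⟨hR, hp, ho, hmin⟩ := hb
  have hle : ∀ k, p k ≤ Function.update p j (p j + 1) k := by
    intro k
    by_cases hk : k = j
    · subst hk; simp
    · simp [hk]
  constructor
  · intro k hk hok
    by_cases hkj : k = j
    · subst hkj
      exact ⟨i, hi, by simp, hR⟩
    · rw [Function.update_of_ne hkj] at hok ⊢
      exact h.owner k hk hok
  · intro k hk k' hk' hok heq
    by_cases h1 : k = j <;> by_cases h2 : k' = j
    · rw [h1, h2]
    · rw [h1, Function.update_self, Function.update_of_ne h2] at heq
      exact absurd heq.symm (ho k' hk')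
    · rw [h2, Function.update_self, Function.update_of_ne h1] at heq
      exact absurd heq (ho k hk)
    · rw [Function.update_of_ne h1, Function.update_of_ne h2] at heq
      rw [Function.update_of_ne h1] at hok
      exact h.inj k hk k' hk' hok heq
  · intro k hk hpk
    by_cases hkj : k = j
    · simp [hkj]
    · rw [Function.update_of_ne hkj] at hpk ⊢
      exact h.pos k hk hpk
  · intro k hk i' hok k' hk' hR'
    by_cases hkj : k = j
    · subst hkj
      rw [Function.update_self] at hok
      obtain rfl : i = i' := by omega
      have := hle k'
      rw [Function.update_self]
      by_contra hlt
      exact hmin k' hk' ⟨hR', by omega⟩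
    · rw [Function.update_of_ne hkj] at hok ⊢
      exact (h.le_add_one k hk i' hok k' hk' hR').trans (Nat.succ_le_succ (hle k'))
  · intro k hk
    by_cases hkj : k = j
    · subst hkj
      simpa using hp
    · rw [Function.update_of_ne hkj]
      exact h.le k hk

/-- The number of columns that are owned. -/
def owned (n : ℕ) (o : ℕ → ℕ) : ℕ := {j ∈ Finset.range n | o j ≠ 0}.card

/-- Weak duality: owned columns outside `C` have distinct owners, all of them in `L`. -/
theorem Auction.owned_le (h : Auction R n p o) {L C : Finset ℕ}
    (hLC : ∀ i < n, ∀ j < n, R i j → i ∈ L ∨ j ∈ C) : owned n o ≤ L.card + C.card := by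
  have h1 : ({j ∈ Finset.range n | o j ≠ 0} \ C).card ≤ L.card := by
    refine Finset.card_le_card_of_injOn (fun j => o j - 1) ?_ ?_
    · intro j hj
      simp only [Finset.coe_sdiff, Finset.coe_filter, Finset.mem_range, Set.mem_sdiff,
        Set.mem_ofPred_eq, Finset.mem_coe] at hj
      obtain ⟨i, hi, hoi, hR⟩ := h.owner j hj.1.1 hj.1.2
      simpa [hoi] using (hLC i hi j hj.1.1 hR).resolve_right hj.2
    · intro j hj j' hj' heq
      simp only [Finset.coe_sdiff, Finset.coe_filter, Finset.mem_range, Set.mem_sdiff,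
        Set.mem_ofPred_eq, Finset.mem_coe] at hj hj' heq
      exact h.inj j hj.1.1 j' hj'.1.1 hj.1.2 (by omega)
  have h2 := Finset.card_le_card_sdiff_add_card (s := {j ∈ Finset.range n | o j ≠ 0}) (t := C)
  unfold owned
  omega

/-- Choose a price level `l` that no column has. Rows with a neighbour cheaper than `l` and columns
dearer than `l` form a cover. Such rows own columns cheaper than `l` and such columns are owned
themselves, so the cover injects into the owned columns. -/
theorem Auction.exists_cover (h : Auction R n p o)
    (hstuck : ∀ i < n, ∀ j < n, ¬ Bids R n p o i j) :
    ∃ L C : Finset ℕ, (∀ i < n, ∀ j < n, R i j → i ∈ L ∨ j ∈ C) ∧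
      L.card + C.card ≤ owned n o := by
  classical
  -- There are `n` columns but `n + 1` levels `0, …, n`.
  obtain ⟨l, hl, hgap⟩ : ∃ l ≤ n, ∀ j < n, p j ≠ l := by
    by_contra! hall
    have h1 : Finset.range (n + 1) ⊆ (Finset.range n).image p := by
      intro l hl
      obtain ⟨j, hj, hp⟩ := hall l (by simpa [Nat.lt_succ_iff] using hl)
      exact Finset.mem_image.2 ⟨j, Finset.mem_range.2 hj, hp⟩
    have h2 := (Finset.card_le_card h1).trans Finset.card_image_le
    simp at h2
  refine ⟨{i ∈ Finset.range n | ∃ j < n, R i j ∧ p j < l}, {j ∈ Finset.range n | l < p j},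
    fun i hi j hj hR => ?_, ?_⟩
  · rcases lt_or_gt_of_ne (hgap j hj) with hlt | hlt
    · exact Or.inl (Finset.mem_filter.2 ⟨Finset.mem_range.2 hi, j, hj, hR, hlt⟩)
    · exact Or.inr (Finset.mem_filter.2 ⟨Finset.mem_range.2 hj, hlt⟩)
  · have h1 : {i ∈ Finset.range n | ∃ j < n, R i j ∧ p j < l} ⊆
        {j ∈ Finset.range n | o j ≠ 0 ∧ p j < l}.image fun j => o j - 1 := by
      intro i hi
      obtain ⟨hi, j₀, hj₀, hR₀, hp₀⟩ := Finset.mem_filter.1 hi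
      have hi := Finset.mem_range.1 hi
      -- An unmatched row could still bid for its cheapest neighbour, whose price is below `l ≤ n`.
      have hmatched : ∃ j < n, o j = i + 1 := by
        by_contra! hun
        obtain ⟨j, hj, hmin⟩ := Finset.exists_min_image {j ∈ Finset.range n | R i j} p
          ⟨j₀, Finset.mem_filter.2 ⟨Finset.mem_range.2 hj₀, hR₀⟩⟩
        have hle := hmin j₀ (Finset.mem_filter.2 ⟨Finset.mem_range.2 hj₀, hR₀⟩)
        obtain ⟨hj, hR⟩ := Finset.mem_filter.1 hj
        refine hstuck i hi j (Finset.mem_range.1 hj) ⟨hR, by omega, hun, fun j' hj' hb => ?_⟩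
        have := hmin j' (Finset.mem_filter.2 ⟨Finset.mem_range.2 hj', hb.1⟩)
        omega
      obtain ⟨j, hj, hoj⟩ := hmatched
      -- The owned column costs at most `p j₀ + 1 ≤ l`, and `l` itself is not a price.
      have := h.le_add_one j hj i hoj j₀ hj₀ hR₀
      have := hgap j hj
      exact Finset.mem_image.2 ⟨j, Finset.mem_filter.2 ⟨Finset.mem_range.2 hj, by omega, by omega⟩,
        by omega⟩
    have h2 := (Finset.card_le_card h1).trans Finset.card_image_le
    have h3 : {j ∈ Finset.range n | o j ≠ 0 ∧ p j < l} ∪ {j ∈ Finset.range n | l < p j} ⊆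
        {j ∈ Finset.range n | o j ≠ 0} := by
      intro j hj
      simp only [Finset.mem_union, Finset.mem_filter, Finset.mem_range] at hj ⊢
      rcases hj with hj | hj
      · exact ⟨hj.1, hj.2.1⟩
      · exact ⟨hj.1, h.pos j hj.1 (by omega)⟩
    have h4 := Finset.card_le_card h3
    rw [Finset.card_union_of_disjoint] at h4
    · unfold owned
      omega
    · rw [Finset.disjoint_left]
      intro j hj hj'
      have := (Finset.mem_filter.1 hj).2.2
      have := (Finset.mem_filter.1 hj').2
      omega

/-- For the adjacency matrix of a bipartite graph, a finished auction finds twice the vertex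
cover number. -/
theorem Auction.owned_eq {H : SimpleGraph (Fin n)} (hH : H.IsBipartite)
    (hR : ∀ i j : Fin n, R i j ↔ H.Adj i j) (h : Auction R n p o)
    (hstuck : ∀ i < n, ∀ j < n, ¬ Bids R n p o i j) :
    owned n o = 2 * H.vertexCoverNum.toNat := by
  classical
  obtain ⟨S, hS⟩ := EternalVC.exists_isMinVertexCover H
  rw [← hS.ncard_eq]
  refine le_antisymm ?_ ?_
  -- A vertex cover, used for the rows and for the columns, covers the double cover.
  · have hcov := h.owned_le (L := S.toFinset.map Fin.valEmbedding)
      (C := S.toFinset.map Fin.valEmbedding) (fun i hi j hj hij => by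
        have := hS.1 ((hR ⟨i, hi⟩ ⟨j, hj⟩).1 hij)
        refine this.imp (fun h => ?_) (fun h => ?_)
        · exact Finset.mem_map.2 ⟨⟨i, hi⟩, by simpa using h, rfl⟩
        · exact Finset.mem_map.2 ⟨⟨j, hj⟩, by simpa using h, rfl⟩)
    rw [Finset.card_map, ← Set.ncard_eq_toFinset_card'] at hcov
    omega
  · obtain ⟨L, C, hLC, hcard⟩ := h.exists_cover hstuck
    obtain ⟨col⟩ := hH
    -- Conversely, a cover of the double cover splits along the colouring into two vertex covers of
    -- `H`, of total size at most `L.card + C.card`.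
    have hcov : ∀ i : Fin 2, H.IsVertexCover
        {x | col x = i ∧ (x : ℕ) ∈ L ∨ col x ≠ i ∧ (x : ℕ) ∈ C} := by
      intro i x y hxy
      have hne := col.valid hxy
      have h1 := hLC x x.2 y y.2 ((hR x y).2 hxy)
      have h2 := hLC y y.2 x x.2 ((hR y x).2 hxy.symm)
      simp only [Set.mem_ofPred_eq]
      by_cases hx : col x = i
      · have hy : col y ≠ i := fun hy => hne (hx.trans hy.symm)
        tauto
      · have hy : col y = i := by
          revert hx hne
          generalize col x = a
          generalize col y = b
          revert i a b
          decide
        tauto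
    have h0 := hS.ncard_le (hcov 0)
    have h1 := hS.ncard_le (hcov 1)
    have hsum : ∀ (D : Finset ℕ) (P : Fin n → Prop),
        {x : Fin n | P x ∧ (x : ℕ) ∈ D}.ncard + {x : Fin n | ¬ P x ∧ (x : ℕ) ∈ D}.ncard ≤
          D.card := by
      intro D P
      rw [← Set.ncard_union_eq (Set.disjoint_left.2 fun x hx hx' => hx'.1 hx.1),
        ← Set.ncard_coe_finset D]
      refine Set.ncard_le_ncard_of_injOn Fin.val ?_ Fin.val_injective.injOn
      rintro x (hx | hx)
      · exact hx.2
      · exact hx.2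
    have hsplit : ∀ i : Fin 2, {x | col x = i ∧ (x : ℕ) ∈ L ∨ col x ≠ i ∧ (x : ℕ) ∈ C}.ncard ≤
        {x | col x = i ∧ (x : ℕ) ∈ L}.ncard + {x | col x ≠ i ∧ (x : ℕ) ∈ C}.ncard :=
      fun i => Set.ncard_union_le _ _
    have hcol : ∀ x, col x = 1 ↔ ¬ col x = 0 := by
      intro x
      generalize col x = a
      revert a
      decide
    have s0 := hsplit 0
    have s1 := hsplit 1
    have t0 := hsum L (fun x => col x = 0)
    have t1 := hsum C (fun x => col x = 0)
    simp only [ne_eq, hcol, not_not] at s0 s1 h0 h1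
    omega

end RAM

namespace RAM

/-! ### Conditions -/

namespace Expr

/-- A condition holds if its value is not `0`. -/
def Holds (n : ℕ) (M : ℕ → ℕ) (e : Expr) (ρ : ℕ → ℕ) (A : Arrays) : Prop := e.eval n M ρ A ≠ 0

instance (n : ℕ) (M : ℕ → ℕ) (e : Expr) (ρ : ℕ → ℕ) (A : Arrays) : Decidable (e.Holds n M ρ A) :=
  inferInstanceAs (Decidable (_ ≠ _))

def not (a : Expr) : Expr := ite a (const 0) (const 1)
def and (a b : Expr) : Expr := ite a b (const 0)
def lt (a b : Expr) : Expr := sub b a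
def eq (a b : Expr) : Expr := not (add (sub a b) (sub b a))
def all (x : ℕ) (a : Expr) : Expr := not (sum x (not a))
def count (x : ℕ) (a : Expr) : Expr := sum x (ite a (const 1) (const 0))

variable {n : ℕ} {M ρ : ℕ → ℕ} {A : Arrays} {a b : Expr}

@[simp] theorem holds_not : (not a).Holds n M ρ A ↔ ¬ a.Holds n M ρ A := by
  simp [not, Holds, eval]

@[simp] theorem holds_and : (and a b).Holds n M ρ A ↔ a.Holds n M ρ A ∧ b.Holds n M ρ A := by
  simp [and, Holds, eval]

@[simp] theorem holds_lt : (lt a b).Holds n M ρ A ↔ a.eval n M ρ A < b.eval n M ρ A := by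
  simp [lt, Holds, eval, Nat.sub_eq_zero_iff_le]

@[simp] theorem holds_eq : (eq a b).Holds n M ρ A ↔ a.eval n M ρ A = b.eval n M ρ A := by
  rw [eq, holds_not, Holds]
  simp only [eval]
  omega

theorem holds_sum {x : ℕ} :
    (sum x a).Holds n M ρ A ↔ ∃ v < n, a.Holds n M (Function.update ρ x v) A := by
  simp [Holds, eval]

@[simp] theorem holds_all {x : ℕ} :
    (all x a).Holds n M ρ A ↔ ∀ v < n, a.Holds n M (Function.update ρ x v) A := by
  simp only [all, holds_not, holds_sum]
  push Not
  rfl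

@[simp] theorem eval_count {x : ℕ} : (count x a).eval n M ρ A =
    {v ∈ Finset.range n | a.Holds n M (Function.update ρ x v) A}.card := by
  rw [Finset.card_filter]
  rfl

/-- The vertices in variables `x` and `y` are adjacent and both different from `v`. -/
def adj (v : Expr) (x y : ℕ) : Expr :=
  and (and (not (eq (var x) v)) (not (eq (var y) v))) (inp (add (sum 7 (var x)) (var y)))

/-- The sum of `n` copies of `var x` stands for the product `n * x`; its dummy variable `7` must not
capture `x`. -/
theorem holds_adj {v : Expr} {x y : ℕ} (hx : x ≠ 7) : (adj v x y).Holds n M ρ A ↔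
    (ρ x ≠ v.eval n M ρ A ∧ ρ y ≠ v.eval n M ρ A) ∧ M (n * ρ x + ρ y) ≠ 0 := by
  simp only [adj, holds_and, holds_not, holds_eq, eval]
  simp [Holds, eval, Function.update_of_ne hx]

end Expr

namespace Cmd

variable {n : ℕ} {M ρ : ℕ → ℕ} {A : Arrays}

/-- Repeat, `n * n` times, for all values of the variables `0` and `1`: if `e` then `c`. -/
def saturate (e : Expr) (c : Cmd) : Cmd := loop 0 (loop 0 (loop 0 (loop 1 (when e c))))

/-- The two outermost loops only count repetitions: their variable `0` is overwritten by the third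
loop. -/
theorem run_saturate {e : Expr} {c : Cmd} {Inv : Arrays → Prop} {m : Arrays → ℕ}
    (hc : ∀ i < n, ∀ j < n, ∀ A, Inv A →
      e.Holds n M (Function.update (Function.update ρ 0 i) 1 j) A →
      Inv (c.run n M (Function.update (Function.update ρ 0 i) 1 j) A) ∧
        m A < m (c.run n M (Function.update (Function.update ρ 0 i) 1 j) A))
    (hm : ∀ A, Inv A → m A ≤ n * n) (hA : Inv A) :
    Inv ((saturate e c).run n M ρ A) ∧ ∀ i < n, ∀ j < n,
      ¬ e.Holds n M (Function.update (Function.update ρ 0 i) 1 j)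
        ((saturate e c).run n M ρ A) := by
  refine iter_saturate
    (c := fun i j A => e.Holds n M (Function.update (Function.update ρ 0 i) 1 j) A)
    (u := fun i j A => c.run n M (Function.update (Function.update ρ 0 i) 1 j) A) hc hm hA ?_
  simp only [saturate, run, Function.update_idem]
  rfl

/-! ### Matchings -/

/-- Reset the auction, whose prices and owners are in the arrays `0` and `1`. -/
def resetAuction : Cmd :=
  loop 0 (seq (set 0 (.var 0) (.const 0)) (set 1 (.var 0) (.const 0)))

/-- Row `0` may bid for column `1`, in the adjacency matrix without the vertex `v`. -/
def bids (v : Expr) : Expr :=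
  .and (.adj v 0 1) (.and (.lt (.get 0 (.var 1)) .size)
    (.and (.all 2 (.not (.eq (.get 1 (.var 2)) (.add (.var 0) (.const 1)))))
      (.all 2 (.not (.and (.adj v 0 2) (.lt (.get 0 (.var 2)) (.get 0 (.var 1))))))))

/-- Run the auction on the adjacency matrix without the vertex `v`. -/
def auction (v : Expr) : Cmd :=
  seq resetAuction (saturate (bids v) (seq (set 1 (.var 1) (.add (.var 0) (.const 1)))
    (set 0 (.var 1) (.add (.get 0 (.var 1)) (.const 1)))))

theorem run_resetAuction :
    (∀ k, k ≠ 0 → k ≠ 1 → (resetAuction.run n M ρ A) k = A k) ∧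
      (∀ j < n, (resetAuction.run n M ρ A) 0 j = 0) ∧
      ∀ j < n, (resetAuction.run n M ρ A) 1 j = 0 := by
  simp only [resetAuction, run, Expr.eval, Function.update_self]
  generalize hN : n = N
  clear hN
  induction N with
  | zero => exact ⟨fun _ _ _ => rfl, by simp, by simp⟩
  | succ N ih =>
    obtain ⟨h1, h2, h3⟩ := ih
    simp only [iter]
    refine ⟨fun k hk0 hk1 => ?_, fun j hj => ?_, fun j hj => ?_⟩
    · rw [Function.update_of_ne hk1, Function.update_of_ne hk0, h1 k hk0 hk1]
    · rw [Function.update_of_ne (show (0 : Fin 8) ≠ 1 by decide), Function.update_self,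
        Function.update_apply]
      split_ifs
      · rfl
      · exact h2 j (by omega)
    · rw [Function.update_self, Function.update_of_ne (show (1 : Fin 8) ≠ 0 by decide),
        Function.update_apply]
      split_ifs
      · rfl
      · exact h3 j (by omega)

/-- Adjacency in the matrix `M`, without the vertex `v`. -/
def AdjWithout (n : ℕ) (M : ℕ → ℕ) (v i j : ℕ) : Prop :=
  (i ≠ v ∧ j ≠ v) ∧ M (n * i + j) ≠ 0

theorem holds_bids {e : Expr} {v i j : ℕ} (he : ∀ i j k A, e.eval n M (Function.update
      (Function.update (Function.update ρ 0 i) 1 j) 2 k) A = v)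
    (he' : ∀ i j A, e.eval n M (Function.update (Function.update ρ 0 i) 1 j) A = v) :
    (bids e).Holds n M (Function.update (Function.update ρ 0 i) 1 j) A ↔
      Bids (AdjWithout n M v) n (A 0) (A 1) i j := by
  simp [bids, Expr.holds_adj, he, he', Expr.eval, Bids, AdjWithout]

/-- The sum of the prices is the measure: each bid raises it, and no price exceeds `n`. The
expression for the removed vertex must keep its value under the bindings of the variables `0`, `1`
and `2`. -/
theorem run_auction {e : Expr} {v : ℕ} (he : ∀ i j k A, e.eval n M (Function.update
      (Function.update (Function.update ρ 0 i) 1 j) 2 k) A = v)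
    (he' : ∀ i j A, e.eval n M (Function.update (Function.update ρ 0 i) 1 j) A = v)
    {H : SimpleGraph (Fin n)} (hH : H.IsBipartite)
    (hR : ∀ i j : Fin n, AdjWithout n M v i j ↔ H.Adj i j) :
    (∀ k, k ≠ 0 → k ≠ 1 → ((auction e).run n M ρ A) k = A k) ∧
      owned n (((auction e).run n M ρ A) 1) = 2 * H.vertexCoverNum.toNat := by
  obtain ⟨h1, h2, h3⟩ := run_resetAuction (n := n) (M := M) (ρ := ρ) (A := A)
  have key := run_saturate (n := n) (M := M) (ρ := ρ) (e := bids e)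
    (c := seq (set 1 (.var 1) (.add (.var 0) (.const 1)))
      (set 0 (.var 1) (.add (.get 0 (.var 1)) (.const 1))))
    (Inv := fun B => (∀ k, k ≠ 0 → k ≠ 1 → B k = A k) ∧
      Auction (AdjWithout n M v) n (B 0) (B 1))
    (m := fun B => ∑ j ∈ Finset.range n, B 0 j) ?_ ?_
    ⟨h1, Auction.zero _ h2 h3⟩
  · refine ⟨key.1.1, Auction.owned_eq hH hR key.1.2 fun i hi j hj => ?_⟩
    exact fun hb => key.2 i hi j hj ((holds_bids he he').2 hb)
  · rintro i hi j hj B ⟨hB, hauc⟩ hb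
    rw [holds_bids he he'] at hb
    have hrun : (seq (set 1 (.var 1) (.add (.var 0) (.const 1)))
        (set 0 (.var 1) (.add (.get 0 (.var 1)) (.const 1)))).run n M
        (Function.update (Function.update ρ 0 i) 1 j) B =
        Function.update (Function.update B 1 (Function.update (B 1) j (i + 1))) 0
          (Function.update (B 0) j (B 0 j + 1)) := by
      simp [run, Expr.eval]
    simp only [hrun]
    refine ⟨⟨fun k hk0 hk1 => ?_, ?_⟩, ?_⟩
    · rw [Function.update_of_ne hk0, Function.update_of_ne hk1, hB k hk0 hk1]
    · simpa using hauc.bid hi hb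
    · rw [Function.update_self]
      refine Finset.sum_lt_sum (fun k _ => ?_) ⟨j, Finset.mem_range.2 hj, by simp⟩
      rw [Function.update_apply]
      split_ifs with h
      · rw [h]; omega
      · exact le_rfl
  · rintro B ⟨-, hauc⟩
    calc ∑ j ∈ Finset.range n, B 0 j ≤ ∑ j ∈ Finset.range n, n :=
          Finset.sum_le_sum fun j hj => hauc.le j (Finset.mem_range.1 hj)
      _ = n * n := by simp

/-- The number of owned columns. -/
def ownedExpr : Expr := .count 0 (.get 1 (.var 0))

theorem eval_ownedExpr : ownedExpr.eval n M ρ A = owned n (A 1) := by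
  simp [ownedExpr, owned, Expr.Holds, Expr.eval]

/-! ### Connected components -/

/-- Label every vertex with a representative of its component, in the array `2`. -/
def components : Cmd :=
  seq (loop 0 (set 2 (.var 0) (.var 0)))
    (saturate (.and (.adj .size 0 1) (.lt (.get 2 (.var 1)) (.get 2 (.var 0))))
      (set 2 (.var 0) (.get 2 (.var 1))))

/-- Every label is a vertex reachable from the labelled one, and updates lower labels. Once none
applies, labels are constant along edges; conversely, vertices with equal labels reach a common
vertex. -/
theorem run_components {G : SimpleGraph (Fin n)}
    (hM : ∀ i j : Fin n, M (n * i + j) ≠ 0 ↔ G.Adj i j) :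
    (∀ u : Fin n, (components.run n M ρ A) 2 u < n) ∧
    ∀ u w : Fin n, (components.run n M ρ A) 2 u = (components.run n M ρ A) 2 w ↔
      G.connectedComponentMk u = G.connectedComponentMk w := by
  set A' := (loop 0 (set 2 (.var 0) (.var 0))).run n M ρ A with hA'
  have hinit : ∀ u < n, A' 2 u = u := by
    simp only [hA', run, Expr.eval, Function.update_self]
    generalize n = N
    induction N with
    | zero => simp
    | succ N ih =>
      intro u hu
      rw [iter, Function.update_self, Function.update_apply]
      split_ifs with h
      · exact h.symm
      · exact ih u (by omega)
  have key := run_saturate (n := n) (M := M) (ρ := ρ) (A := A')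
    (e := .and (.adj .size 0 1) (.lt (.get 2 (.var 1)) (.get 2 (.var 0))))
    (c := set 2 (.var 0) (.get 2 (.var 1)))
    (Inv := fun B => ∀ u : Fin n, ∃ w : Fin n, B 2 u = w ∧ G.Reachable u w)
    (m := fun B => ∑ u ∈ Finset.range n, (n - B 2 u)) ?_ ?_ ?_
  · change (∀ u : Fin n, ∃ w : Fin n, (components.run n M ρ A) 2 u = w ∧ G.Reachable u w) ∧
      (∀ i < n, ∀ j < n, ¬ Expr.Holds n M _ _ (components.run n M ρ A)) at key
    generalize components.run n M ρ A = B at key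
    obtain ⟨hr, hs⟩ := key
    have hadj : ∀ u w : Fin n, G.Adj u w → B 2 u ≤ B 2 w := by
      intro u w huw
      by_contra! hlt
      refine hs u u.2 w w.2 ?_
      have h1 := u.2.ne
      have h2 := w.2.ne
      have h3 := (hM u w).2 huw
      simp [Expr.holds_adj, Expr.eval, h1, h2, h3, hlt]
    refine ⟨fun u => ?_, fun u w => ⟨fun h => ?_, fun h => ?_⟩⟩
    · obtain ⟨w, hw, -⟩ := hr u
      rw [hw]
      exact w.2
    · obtain ⟨x, hx, hux⟩ := hr u
      obtain ⟨y, hy, hwy⟩ := hr w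
      obtain rfl : x = y := Fin.ext (hx.symm.trans (h.trans hy))
      exact SimpleGraph.ConnectedComponent.sound (hux.trans hwy.symm)
    · obtain ⟨p⟩ := SimpleGraph.ConnectedComponent.exact h
      clear h
      induction p with
      | nil => rfl
      | cons h _ ih => exact (le_antisymm (hadj _ _ h) (hadj _ _ h.symm)).trans ih
  · intro i hi j hj B hB hc
    simp only [Expr.holds_and, Expr.holds_adj (show (0 : ℕ) ≠ 7 by decide), Expr.holds_lt,
      Expr.eval, Function.update_self, ne_eq, zero_ne_one, not_false_eq_true,
      Function.update_of_ne] at hc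
    have hrun : (set 2 (.var 0) (.get 2 (.var 1))).run n M
        (Function.update (Function.update ρ 0 i) 1 j) B =
        Function.update B 2 (Function.update (B 2) i (B 2 j)) := by
      simp [run, Expr.eval]
    simp only [hrun, Function.update_self]
    have hij : G.Adj ⟨i, hi⟩ ⟨j, hj⟩ := (hM ⟨i, hi⟩ ⟨j, hj⟩).1 hc.1.2
    refine ⟨fun u => ?_, ?_⟩
    · by_cases hu : (u : ℕ) = i
      · obtain ⟨w, hw, hjw⟩ := hB ⟨j, hj⟩
        obtain rfl : u = ⟨i, hi⟩ := Fin.ext hu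
        exact ⟨w, by rw [Function.update_self, hw], hij.reachable.trans hjw⟩
      · rw [Function.update_of_ne hu]
        exact hB u
    · refine Finset.sum_lt_sum (fun k _ => ?_) ⟨i, Finset.mem_range.2 hi, ?_⟩
      · rw [Function.update_apply]
        split_ifs with h
        · rw [h]; omega
        · exact le_rfl
      · rw [Function.update_self]
        obtain ⟨w, hw, -⟩ := hB ⟨i, hi⟩
        have := w.2
        simp only at hw
        omega
  · intro B _
    calc ∑ u ∈ Finset.range n, (n - B 2 u) ≤ ∑ u ∈ Finset.range n, n :=
          Finset.sum_le_sum fun j hj => Nat.sub_le _ _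
      _ = n * n := by simp
  · exact fun u => ⟨u, hinit u u.2, SimpleGraph.Reachable.refl u⟩

end Cmd

end RAM

namespace RAM

open EternalVC

/-! ### Reading the invariants of the graph off the program -/

theorem graphInput_mem_ne_zero {n : ℕ} (G : SimpleGraph (Fin n)) (i j : Fin n) :
    (graphInput G).mem (n * i + j) ≠ 0 ↔ G.Adj i j := by
  have hn : 0 < n := i.pos
  simp only [graphInput, ne_eq, ite_eq_right_iff, one_ne_zero, imp_false, not_not]
  refine ⟨?_, fun h => ⟨i, j, rfl, h⟩⟩
  rintro ⟨i', j', h, hadj⟩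
  have h1 := congrArg (· / n) h
  have h2 := congrArg (· % n) h
  simp only [Nat.mul_add_div hn, Nat.mul_add_mod, Nat.div_eq_of_lt j.2, Nat.div_eq_of_lt j'.2,
    Nat.mod_eq_of_lt j.2, Nat.mod_eq_of_lt j'.2, add_zero] at h1 h2
  rwa [Fin.ext h1, Fin.ext h2]

/-- Isolating `v` instead of deleting it keeps the vertex set `Fin n`, and an isolated vertex does
not affect the cover number. -/
theorem vertexCoverNum_deleteIncidenceSet {V : Type*} (G : SimpleGraph V) (v : V) :
    (G.deleteIncidenceSet v).vertexCoverNum = (G.induce {v}ᶜ).vertexCoverNum := by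
  refine le_antisymm ?_ ?_
  · obtain ⟨S, hS⟩ := exists_isMinVertexCover (G.induce {v}ᶜ)
    rw [← hS.2, ← Subtype.val_injective.encard_image]
    refine SimpleGraph.IsVertexCover.vertexCoverNum_le fun x y hxy => ?_
    rw [SimpleGraph.deleteIncidenceSet_adj] at hxy
    rcases @hS.1 ⟨x, hxy.2.1⟩ ⟨y, hxy.2.2⟩ hxy.1 with h | h
    · exact Or.inl ⟨_, h, rfl⟩
    · exact Or.inr ⟨_, h, rfl⟩
  · refine SimpleGraph.IsContained.vertexCoverNum_le_vertexCoverNum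
      ⟨⟨⟨Subtype.val, fun {x y} h => ?_⟩, Subtype.val_injective⟩⟩
    rw [SimpleGraph.deleteIncidenceSet_adj]
    exact ⟨h, x.2, y.2⟩

/-- Stated with doubled cover numbers because these are what the auction returns. -/
theorem badLeaf_iff {V : Type*} [Finite V] {G : SimpleGraph V} {v : V} :
    BadLeaf G v ↔ IsDegreeOne G v ∧
      2 * (G.deleteIncidenceSet v).vertexCoverNum.toNat + 2 ≠ 2 * G.vertexCoverNum.toNat := by
  have h := exists_isMinVertexCover_mem_iff (G := G) v
  rw [← vertexCoverNum_deleteIncidenceSet, ← coe_vertexCoverNum_toNat,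
    ← coe_vertexCoverNum_toNat (G := G)] at h
  norm_cast at h
  unfold BadLeaf
  refine and_congr_right fun _ => ?_
  rw [← not_iff_not]
  push Not
  rw [h]
  omega

/-- Maps with the same fibres have equally large images; this lets labels be counted in place of
components. -/
theorem ncard_image_congr {α β γ : Type*} {f : α → β} {g : α → γ}
    (h : ∀ x y, f x = f y ↔ g x = g y) (S : Set α) : (f '' S).ncard = (g '' S).ncard := by
  refine Set.ncard_congr (fun y hy => g hy.choose) ?_ ?_ ?_
  · exact fun y hy => ⟨_, hy.choose_spec.1, rfl⟩
  · intro y y' hy hy' he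
    rw [← hy.choose_spec.2, ← hy'.choose_spec.2]
    exact (h _ _).2 he
  · rintro _ ⟨x, hx, rfl⟩
    exact ⟨f x, ⟨x, hx, rfl⟩, (h _ _).1 (Exists.choose_spec (⟨x, hx, rfl⟩ : f x ∈ f '' S)).2⟩

namespace Cmd

/-- Vertex `3` is a leaf, and the last auction shows that it lies in no minimum vertex cover. -/
def leafTest : Expr :=
  .and (.eq (.count 0 (.adj .size 3 0)) (.const 1))
    (.not (.eq (.add ownedExpr (.const 2)) (.get 3 (.const 0))))

/-- Compute labels of the components, twice the vertex cover number, and a mark for every leaf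
that lies in no minimum vertex cover, into the arrays `2`, `3` and `4`. -/
def analyze : Cmd :=
  seq components (seq (auction .size) (seq (set 3 (.const 0) ownedExpr)
    (loop 3 (seq (auction (.var 3)) (set 4 (.var 3) (.ite leafTest (.const 1) (.const 0)))))))

/-- The vertex cover number. -/
def coverExpr : Expr :=
  .count 0 (.lt (.add (.add (.var 0) (.var 0)) (.const 1)) (.get 3 (.const 0)))

/-- The number of components with a marked leaf. -/
def badExpr : Expr :=
  .count 0 (.sum 1 (.and (.get 4 (.var 1)) (.eq (.get 2 (.var 1)) (.var 0))))

/-- Whether there is no marked leaf. -/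
def criterionExpr : Expr := .ite (.sum 0 (.get 4 (.var 0))) (.const 0) (.const 1)

variable {n : ℕ} {G : SimpleGraph (Fin n)} {ρ : ℕ → ℕ} {A : Arrays}

theorem holds_leafTest {v : Fin n}
    (h1 : owned n (A 1) = 2 * (G.deleteIncidenceSet v).vertexCoverNum.toNat)
    (h3 : A 3 0 = 2 * G.vertexCoverNum.toNat) :
    leafTest.Holds n (graphInput G).mem (Function.update ρ 3 v) A ↔ BadLeaf G v := by
  have hdeg : {w ∈ Finset.range n | (Expr.adj .size 3 0).Holds n (graphInput G).mem
      (Function.update (Function.update ρ 3 v) 0 w) A}.card = 1 ↔ IsDegreeOne G v := by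
    have himage : (({w ∈ Finset.range n | (Expr.adj .size 3 0).Holds n (graphInput G).mem
        (Function.update (Function.update ρ 3 v) 0 w) A} : Finset ℕ) : Set ℕ) =
        Fin.val '' G.neighborSet v := by
      ext w
      simp only [Expr.holds_adj (show (3 : ℕ) ≠ 7 by decide), Expr.eval, Finset.coe_filter,
        Finset.mem_range, Set.mem_ofPred_eq, Set.mem_image, SimpleGraph.mem_neighborSet,
        Function.update_self, Function.update_of_ne (show (3 : ℕ) ≠ 0 by decide)]
      constructor
      · rintro ⟨hw, -, h⟩
        exact ⟨⟨w, hw⟩, (graphInput_mem_ne_zero G v ⟨w, hw⟩).1 h, rfl⟩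
      · rintro ⟨w, hw, rfl⟩
        exact ⟨w.2, ⟨v.2.ne, w.2.ne⟩, (graphInput_mem_ne_zero G v w).2 hw⟩
    unfold IsDegreeOne
    rw [← Fin.val_injective.encard_image, ← himage, Set.encard_coe_eq_coe_finsetCard]
    norm_cast
  rw [leafTest, Expr.holds_and, Expr.holds_eq, Expr.eval_count, Expr.holds_not, Expr.holds_eq,
    badLeaf_iff]
  simp only [Expr.eval]
  rw [hdeg, eval_ownedExpr, h1, h3]

/-- An auction writes only to the arrays `0` and `1`, so labels, cover number and earlier marks
survive the later auctions. -/
theorem run_analyze (hG : G.IsBipartite) :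
    (∀ u : Fin n, (analyze.run n (graphInput G).mem ρ A) 2 u < n) ∧
    (∀ u w : Fin n, (analyze.run n (graphInput G).mem ρ A) 2 u =
      (analyze.run n (graphInput G).mem ρ A) 2 w ↔
        G.connectedComponentMk u = G.connectedComponentMk w) ∧
    (analyze.run n (graphInput G).mem ρ A) 3 0 = 2 * G.vertexCoverNum.toNat ∧
    ∀ v : Fin n, (analyze.run n (graphInput G).mem ρ A) 4 v ≠ 0 ↔ BadLeaf G v := by
  have hcomp := run_components (ρ := ρ) (A := A) (graphInput_mem_ne_zero G)
  -- The number `n` is not a vertex, so nothing is removed in this auction.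
  have hall := run_auction (n := n) (M := (graphInput G).mem) (ρ := ρ) (e := .size) (v := n)
    (A := components.run n (graphInput G).mem ρ A)
    (fun _ _ _ _ => rfl) (fun _ _ _ => rfl) hG
    (fun i j => by
      rw [AdjWithout, graphInput_mem_ne_zero]
      exact and_iff_right ⟨i.2.ne, j.2.ne⟩)
  simp only [analyze, run]
  set A₀ := components.run n (graphInput G).mem ρ A
  set A₁ := (auction .size).run n (graphInput G).mem ρ A₀
  have hval : (Expr.const 0).eval n (graphInput G).mem ρ A₁ = 0 := rfl
  rw [hval, eval_ownedExpr, hall.2]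
  set A₂ := Function.update A₁ 3 (Function.update (A₁ 3) 0 (2 * G.vertexCoverNum.toNat)) with hA₂
  have h2 : A₂ 2 = A₀ 2 := by
    rw [hA₂, Function.update_of_ne (by decide), hall.1 2 (by decide) (by decide)]
  have h3 : A₂ 3 0 = 2 * G.vertexCoverNum.toNat := by simp [hA₂]
  have hloop : ∀ N ≤ n, ∀ B, B = iter (fun v A => Function.update
        ((auction (.var 3)).run n (graphInput G).mem (Function.update ρ 3 v) A) 4
        (Function.update ((auction (.var 3)).run n (graphInput G).mem (Function.update ρ 3 v) A 4)
          ((Expr.var 3).eval n (graphInput G).mem (Function.update ρ 3 v)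
            ((auction (.var 3)).run n (graphInput G).mem (Function.update ρ 3 v) A))
          ((Expr.ite leafTest (.const 1) (.const 0)).eval n (graphInput G).mem
            (Function.update ρ 3 v)
            ((auction (.var 3)).run n (graphInput G).mem (Function.update ρ 3 v) A)))) N A₂ →
      B 2 = A₀ 2 ∧ B 3 0 = 2 * G.vertexCoverNum.toNat ∧
        ∀ v : Fin n, (v : ℕ) < N → (B 4 v ≠ 0 ↔ BadLeaf G v) := by
    intro N
    induction N with
    | zero =>
      rintro - B rfl
      exact ⟨h2, h3, fun v hv => absurd hv (Nat.not_lt_zero _)⟩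
    | succ N ih =>
      rintro hN B rfl
      obtain ⟨i2, i3, i4⟩ := ih (by omega) _ rfl
      rw [iter]
      set C := iter _ N A₂
      have hauc := run_auction (n := n) (M := (graphInput G).mem) (ρ := Function.update ρ 3 N)
        (e := .var 3) (v := N) (A := C)
        (fun _ _ _ _ => by simp [Expr.eval]) (fun _ _ _ => by simp [Expr.eval])
        (H := G.deleteIncidenceSet ⟨N, hN⟩) (hG.mono_left (G.deleteIncidenceSet_le _))
        (fun i j => by
          rw [AdjWithout, graphInput_mem_ne_zero, SimpleGraph.deleteIncidenceSet_adj, and_comm]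
          simp only [ne_eq, Fin.ext_iff])
      set C' := (auction (.var 3)).run n (graphInput G).mem (Function.update ρ 3 N) C
      have c3 : C' 3 0 = 2 * G.vertexCoverNum.toNat := by
        rw [hauc.1 3 (by decide) (by decide), i3]
      have hvar : (Expr.var 3).eval n (graphInput G).mem (Function.update ρ 3 N) C' = N := by
        simp [Expr.eval]
      have htest : (Expr.ite leafTest (.const 1) (.const 0)).eval n (graphInput G).mem
          (Function.update ρ 3 N) C' ≠ 0 ↔ BadLeaf G ⟨N, hN⟩ := by
        rw [← holds_leafTest (ρ := ρ) hauc.2 c3]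
        simp [Expr.eval, Expr.Holds]
      refine ⟨?_, ?_, fun v hv => ?_⟩
      · rw [Function.update_of_ne (by decide), hauc.1 2 (by decide) (by decide), i2]
      · rw [Function.update_of_ne (by decide), c3]
      · rw [Function.update_self, hvar]
        by_cases hvN : (v : ℕ) = N
        · obtain rfl : v = ⟨N, hN⟩ := Fin.ext hvN
          rw [Function.update_self]
          exact htest
        · rw [Function.update_of_ne hvN, hauc.1 4 (by decide) (by decide)]
          exact i4 v (by omega)
  obtain ⟨r2, r3, r4⟩ := hloop n le_rfl _ rfl
  rw [r2]
  exact ⟨hcomp.1, hcomp.2, r3, fun v => r4 v v.2⟩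

/-- Halving without division: `2x + 1 < 2k` holds exactly for `x < k`, and `k ≤ n` keeps these
values in range. -/
theorem eval_coverExpr {M : ℕ → ℕ} (h : A 3 0 = 2 * G.vertexCoverNum.toNat) :
    coverExpr.eval n M ρ A = G.vertexCoverNum.toNat := by
  have hle : G.vertexCoverNum.toNat ≤ n := by
    obtain ⟨S, hS⟩ := exists_isMinVertexCover G
    rw [← hS.ncard_eq]
    simpa using Set.ncard_le_card S
  rw [coverExpr, Expr.eval_count]
  simp only [Expr.holds_lt, Expr.eval, Function.update_self, h]
  rw [show {x ∈ Finset.range n | x + x + 1 < 2 * G.vertexCoverNum.toNat} =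
    Finset.range G.vertexCoverNum.toNat by
      ext x
      simp only [Finset.mem_filter, Finset.mem_range]
      omega, Finset.card_range]

/-- Labels are below `n`, so counting the values `c < n` that label some bad leaf misses no
component. -/
theorem eval_badExpr {M : ℕ → ℕ} (hlt : ∀ u : Fin n, A 2 u < n)
    (hlab : ∀ u w : Fin n, A 2 u = A 2 w ↔
      G.connectedComponentMk u = G.connectedComponentMk w)
    (hbad : ∀ v : Fin n, A 4 v ≠ 0 ↔ BadLeaf G v) :
    badExpr.eval n M ρ A = (badComponents G).ncard := by
  rw [badExpr, Expr.eval_count, badComponents, ← ncard_image_congr hlab, ← Set.ncard_coe_finset]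
  congr 1
  ext c
  have h01 : (0 : ℕ) ≠ 1 := zero_ne_one
  simp only [Expr.holds_sum, Expr.holds_and, Expr.holds_eq, Expr.eval, Function.update_self,
    Function.update_of_ne h01, Finset.coe_filter, Finset.mem_range, Set.mem_ofPred_eq,
    Set.mem_image]
  simp only [Expr.Holds, Expr.eval, Function.update_self]
  constructor
  · rintro ⟨-, u, hu, h4, h2⟩
    exact ⟨⟨u, hu⟩, (hbad ⟨u, hu⟩).1 h4, h2⟩
  · rintro ⟨u, hu, rfl⟩
    exact ⟨hlt u, u, u.2, (hbad u).2 hu, rfl⟩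

open Classical in
theorem eval_criterionExpr {M : ℕ → ℕ} (hbad : ∀ v : Fin n, A 4 v ≠ 0 ↔ BadLeaf G v) :
    criterionExpr.eval n M ρ A = if LeafCriterion G then 1 else 0 := by
  have h : (Expr.sum 0 (.get 4 (.var 0))).Holds n M ρ A ↔ ¬ LeafCriterion G := by
    rw [Expr.holds_sum, leafCriterion_iff]
    push Not
    simp only [Expr.Holds, Expr.eval, Function.update_self]
    exact ⟨fun ⟨v, hv, h⟩ => ⟨⟨v, hv⟩, (hbad ⟨v, hv⟩).1 h⟩, fun ⟨v, h⟩ => ⟨v, v.2, (hbad v).2 h⟩⟩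
  rw [criterionExpr, Expr.eval]
  change (if Expr.Holds _ _ _ _ _ then 0 else 1) = _
  by_cases hc : LeafCriterion G
  · rw [if_neg (h.not.2 (not_not.2 hc)), if_pos hc]
  · rw [if_pos (h.2 hc), if_neg hc]

end Cmd

end RAM

/-! ### The main theorem -/

open Classical in
theorem mainTheorem7 :
    -- the New Eternal Vertex Cover number of bipartite graphs is computable in polynomial time
    RAM.PolyTimeOnGraphs (fun {_} G => G.IsBipartite) (fun {_} G => EternalVC.nevc G) ∧
    -- its value, the criterion, and the reduction of the criterion to vertex cover computations
    (∀ (V : Type*) [Finite V] (G : SimpleGraph V), G.IsBipartite →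
      (G.Connected →
        (EternalVC.nevc G : ℕ∞) = G.vertexCoverNum ∨
        (EternalVC.nevc G : ℕ∞) = G.vertexCoverNum + 1) ∧
      ((EternalVC.nevc G : ℕ∞) = G.vertexCoverNum ↔ EternalVC.LeafCriterion G) ∧
      (∀ v, EternalVC.IsDegreeOne G v →
        (G.induce {v}ᶜ).IsBipartite ∧
        ((∃ S, EternalVC.IsMinVertexCover G S ∧ v ∈ S) ↔
          (G.induce {v}ᶜ).vertexCoverNum + 1 = G.vertexCoverNum))) ∧
    -- these computations, and hence the test of the criterion, take polynomial time
    RAM.PolyTimeOnGraphs (fun {_} G => G.IsBipartite) (fun {_} G => G.vertexCoverNum.toNat) ∧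
    RAM.PolyTimeOnGraphs (fun {_} G => G.IsBipartite)
      (fun {_} G => if EternalVC.LeafCriterion G then 1 else 0) := by
  refine ⟨RAM.polyTimeOnGraphs_of_cmd RAM.Cmd.analyze (.add RAM.Cmd.coverExpr RAM.Cmd.badExpr)
      fun n G hG => ?_, fun V _ G hG => ⟨EternalVC.nevc_of_connected hG,
        EternalVC.nevc_eq_vertexCoverNum_iff hG, fun v _ => ⟨?_,
          EternalVC.exists_isMinVertexCover_mem_iff v⟩⟩,
    RAM.polyTimeOnGraphs_of_cmd RAM.Cmd.analyze RAM.Cmd.coverExpr fun n G hG => ?_,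
    RAM.polyTimeOnGraphs_of_cmd RAM.Cmd.analyze RAM.Cmd.criterionExpr fun n G hG => ?_⟩
  · obtain ⟨h1, h2, h3, h4⟩ := RAM.Cmd.run_analyze (ρ := fun _ => 0) (A := fun _ _ => 0) hG
    rw [RAM.Expr.eval, RAM.Cmd.eval_coverExpr h3, RAM.Cmd.eval_badExpr h1 h2 h4]
    exact (EternalVC.nevc_eq hG).symm
  · exact SimpleGraph.Colorable.of_hom (SimpleGraph.Embedding.induce _).toHom hG
  · obtain ⟨-, -, h3, -⟩ := RAM.Cmd.run_analyze (ρ := fun _ => 0) (A := fun _ _ => 0) hG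
    exact RAM.Cmd.eval_coverExpr h3
  · obtain ⟨-, -, -, h4⟩ := RAM.Cmd.run_analyze (ρ := fun _ => 0) (A := fun _ _ => 0) hG
    exact RAM.Cmd.eval_criterionExpr h4
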